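/- **Setting.** Let $P_0,P_1$ be distributions on a finite alphabet $\mathcal Y$ with finite relative entropy $D(P_1\|P_0)=\sum_y P_1(y)\log_2\frac{P_1(y)}{P_0(y)}$ (that is, $P_0(y)=0$ implies $P_1(y)=0$). For $\alpha>0$ and $n\ge 1$ let $A_n=\lfloor 2^{\alpha n}\rfloor$, and let $\nu_n$ be uniform on $\{1,\dots,A_n\}$. Given $\nu_n$, the observations $Y_1,\dots,Y_{A_n+n-1}$ are independent, with law $P_1$ at the times $\nu_n,\dots,\nu_n+n-1$ and law $P_0$ at all other times. A detector $(\mathcal S,\tau)$ consists of a (possibly randomized) adaptive set of sampling times $\mathcal S=\{S_1<S_2<\cdots\}\subseteq\{1,\dots,A_n+n-1\}$, each $S_j$ being a function of $(Y_{S_i})_{i<j}$ and of randomness independent of $\nu_n$ and of $(Y_t)$, and of a (possibly randomized) stopping time $\tau\in\{1,\dots,A_n+n-1\}$ with respect to the sampled process. Write $\mathcal S^{\le\tau}=\{s\in\mathcal S:s\le\tau\}$. Its false-alarm probability is $\mathbb P(\tau<\nu_n)$. For $\varepsilon\ge 0$ its delay $d((\mathcal S,\tau),\varepsilon)$ is the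 minimum integer $l\ge0$ with $\mathbb P(\tau-\nu_n\le l-1)\ge 1-\varepsilon$, and its sampling rate $\rho((\mathcal S,\tau),\varepsilon)$ is the minimum $r\ge0$ with $\mathbb P(|\mathcal S^{\le\tau}|/\tau\le r)\ge1-\varepsilon$. A non-increasing sequence $\{\rho_n\}$ in $[0,1]$ is achieved at uncertainty exponent $\alpha$ by the detectors $\{(\mathcal S_n,\tau_n)\}$ with error levels $\varepsilon_n\ge 0$, $\varepsilon_n\to0$, if for all $n$ large enough $\mathbb P(\tau_n<\nu_n)\le\varepsilon_n$, $\rho((\mathcal S_n,\tau_n),\varepsilon_n)\le\rho_n$ and $\frac1n\log_2 d((\mathcal S_n,\tau_n),\varepsilon_n)\le\varepsilon_n$; it is achievable if such detectors and error levels exist. Write $d_n=d((\mathcal S_n,\tau_n),\varepsilon_n)$ and $n^*(\alpha)=n\alpha/D(P_1\|P_0)$. **Theorem 2 (Detection, sparse sampling).** Fix $\alpha\in(0,D(P_1\|P_0))$, and let $\{\rho_n\}$ be a non-increasing sequence in $[0,1]$. 1. If $\rho_n=\omega(1/n)$, then $\{\rho_n\}$ is achieved at uncertainty exponent $\alpha$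 by some detectors and error levels with $\limsup_{n\to\infty} d_n/n^*(\alpha)\le 1$. 2. Conversely, if $\rho_n=o(1/n)$, then $\{\rho_n\}$ is not achievable at uncertainty exponent $\alpha$. More precisely: (a) there is $\delta>0$ such that for all detectors $(\mathcal S_n,\tau_n)$ and all error levels $\varepsilon_n\ge0$, $\varepsilon_n\to0$, with $\rho((\mathcal S_n,\tau_n),\varepsilon_n)\le\rho_n$ for all $n$ large enough, the detector samples only from $P_0$ with probability bounded away from zero: $\mathbb P(\{\nu_n,\dots,\nu_n+n-1\}\cap\mathcal S_n^{\le\tau_n}=\emptyset)\ge\delta$ for all $n$ large enough; (b) if such detectors moreover have vanishing false-alarm probability, $\mathbb P(\tau_n<\nu_n)\to0$, then $d_n=\Theta(2^{\alpha n})$. -/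

import Mathlib

open MeasureTheory Filter Topology Asymptotics

/-- The observation times `1, …, N`. -/
abbrev ObsTime (N : ℕ) : Type := Set.Icc (1 : ℕ) N

/-- The sampling times of a finite set, listed in increasing order `S_1 < S_2 < ⋯ < S_ℓ`. -/
def samplingTimes {N : ℕ} (s : Finset (ObsTime N)) : List (ObsTime N) :=
  s.sort (· ≤ ·)

/-- The sampling set `S`, a function of the observed path, is adaptive: the next sampling time
(or the decision `none` to take no further sample) is a function `g` of the values
`Y_{S_1}, …, Y_{S_j}` that were sampled so far. -/
def IsAdaptive {𝒴 : Type*} {N : ℕ} (S : (ObsTime N → 𝒴) → Finset (ObsTime N)) : Prop :=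
  ∃ g : List 𝒴 → Option (ObsTime N), ∀ (y : ObsTime N → 𝒴) (j : ℕ),
    (samplingTimes (S y))[j]? = g (((samplingTimes (S y)).take j).map y)

/-- `τ` is a stopping time of the sampled process: whether `τ = t` is decided by the samples
taken at times `≤ t`. -/
def IsSampledStoppingTime {𝒴 : Type*} {N : ℕ} (S : (ObsTime N → 𝒴) → Finset (ObsTime N))
    (τ : (ObsTime N → 𝒴) → ObsTime N) : Prop :=
  ∀ y y' : ObsTime N → 𝒴, (∀ s ∈ S y, s ≤ τ y → y' s = y s) → τ y' = τ y

/-- A (randomized, adaptive) detector `(S, τ)` on the time horizon `{1, …, N}`. All internal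
randomization is carried by a seed, which is independent of the observed process. -/
structure Detector (𝒴 : Type*) (N : ℕ) where
  Seed : Type
  [seedSpace : MeasurableSpace Seed]
  seedLaw : Measure Seed
  [seedProb : IsProbabilityMeasure seedLaw]
  /-- the sampling set -/
  S : Seed → (ObsTime N → 𝒴) → Finset (ObsTime N)
  /-- the stopping rule -/
  τ : Seed → (ObsTime N → 𝒴) → ObsTime N
  measurable_S : ∀ y t, MeasurableSet {r | t ∈ S r y}
  measurable_τ : ∀ y t, MeasurableSet {r | τ r y = t}
  adaptive : ∀ r, IsAdaptive (S r)
  stopping : ∀ r, IsSampledStoppingTime (S r) (τ r)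

attribute [instance] Detector.seedSpace Detector.seedProb

/-- The time horizon `A + n - 1` (for `n ≥ 1`). -/
def horizon (A n : ℕ) : ℕ := A + (n - 1)

/-- The uncertainty level `A_n = 2 ^ (α n)`, rounded down to an integer. -/
noncomputable def uncertaintyLevel (α : ℝ) (n : ℕ) : ℕ := ⌊(2 : ℝ) ^ (α * n)⌋₊

/-- Relative entropy `D(P ‖ Q)` in bits. -/
noncomputable def relEntropy {𝒴 : Type*} [Fintype 𝒴] (P Q : PMF 𝒴) : ℝ :=
  ∑ y, (P y).toReal * Real.logb 2 ((P y).toReal / (Q y).toReal)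

section Model

variable {𝒴 : Type*} [MeasurableSpace 𝒴]

/-- The law of the observations `Y_1, …, Y_N` given that the change starts at time `j`: independent,
with law `P₁` at the times `j, …, j + n - 1` and with law `P₀` at all other times. -/
noncomputable def pathLaw (P₀ P₁ : PMF 𝒴) (N n j : ℕ) : Measure (ObsTime N → 𝒴) :=
  Measure.pi fun t => if j ≤ t.1 ∧ t.1 < j + n then P₁.toMeasure else P₀.toMeasure

variable (P₀ P₁ : PMF 𝒴) {A n : ℕ} (D : Detector 𝒴 (horizon A n))

/-- An outcome `(ν, (Y, seed))`: the change point, the observations, the internal randomization. -/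
abbrev Outcome : Type _ := ℕ × ((ObsTime (horizon A n) → 𝒴) × D.Seed)

/-- The joint law of the change point (uniform on `{1, …, A}`), of the observations, and of the
seed (independent of both). -/
noncomputable def jointLaw : Measure (Outcome D) :=
  ∑ j ∈ Finset.Icc 1 A, (A : ENNReal)⁻¹ •
    (Measure.dirac j).prod ((pathLaw P₀ P₁ (horizon A n) n j).prod D.seedLaw)

/-- The stopping time as a random variable. -/
def stopTime (ω : Outcome D) : ℕ := (D.τ ω.2.2 ω.2.1 : ℕ)

/-- The samples taken up to the stopping time. -/
def samplesTaken (ω : Outcome D) : Finset (ObsTime (horizon A n)) :=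
  (D.S ω.2.2 ω.2.1).filter (· ≤ D.τ ω.2.2 ω.2.1)

/-- The probability of false alarm, `ℙ(τ < ν)`. -/
noncomputable def falseAlarm : ℝ := (jointLaw P₀ P₁ D).real {ω | stopTime D ω < ω.1}

/-- The delay: the minimum `l ≥ 0` such that `ℙ(τ - ν ≤ l - 1) ≥ 1 - ε`. -/
noncomputable def detectionDelay (ε : ℝ) : ℕ :=
  sInf {l : ℕ | 1 - ε ≤
    (jointLaw P₀ P₁ D).real {ω | (stopTime D ω : ℤ) - (ω.1 : ℤ) ≤ (l : ℤ) - 1}}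

/-- The sampling rate: the minimum `r ≥ 0` such that `ℙ(|S^{≤ τ}| / τ ≤ r) ≥ 1 - ε`. -/
noncomputable def samplingRate (ε : ℝ) : ℝ :=
  sInf {r : ℝ | 0 ≤ r ∧ 1 - ε ≤
    (jointLaw P₀ P₁ D).real {ω | ((samplesTaken D ω).card : ℝ) / (stopTime D ω : ℝ) ≤ r}}

/-- The probability that the detector only samples from `P₀`: up to the stopping time, no sample
is taken at any of the times `ν, …, ν + n - 1`. -/
noncomputable def missProb : ℝ :=
  (jointLaw P₀ P₁ D).real {ω | ∀ s ∈ samplesTaken D ω, ¬ (ω.1 ≤ s.1 ∧ s.1 < ω.1 + n)}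

end Model

/-- Admissible sequences of sampling rates: non-increasing with values in `[0, 1]`. -/
def IsRateSequence (ρ : ℕ → ℝ) : Prop := Antitone ρ ∧ ∀ n, 0 ≤ ρ n ∧ ρ n ≤ 1

/-- A sequence of detectors, the `n`-th one for change duration `n` and uncertainty level `A_n`. -/
abbrev DetectorSeq (𝒴 : Type*) (α : ℝ) : Type _ :=
  (n : ℕ) → Detector 𝒴 (horizon (uncertaintyLevel α n) n)

/-- Nonnegative error levels that tend to zero. -/
def IsVanishing (ε : ℕ → ℝ) : Prop := (∀ n, 0 ≤ ε n) ∧ Tendsto ε atTop (𝓝 0)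

/-- The detectors `D` achieve the sampling rates `ρ` at uncertainty exponent `α`, with error
levels `ε`. -/
def Achieves {𝒴 : Type*} [MeasurableSpace 𝒴] (P₀ P₁ : PMF 𝒴) {α : ℝ} (D : DetectorSeq 𝒴 α)
    (ε ρ : ℕ → ℝ) : Prop :=
  IsVanishing ε ∧ ∀ᶠ n : ℕ in atTop,
    falseAlarm P₀ P₁ (D n) ≤ ε n ∧
    samplingRate P₀ P₁ (D n) (ε n) ≤ ρ n ∧
    1 / (n : ℝ) * Real.logb 2 (detectionDelay P₀ P₁ (D n) (ε n)) ≤ ε n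

/-- The sampling rates `ρ` are achievable at uncertainty exponent `α`. -/
def IsAchievable {𝒴 : Type*} [MeasurableSpace 𝒴] (P₀ P₁ : PMF 𝒴) (α : ℝ) (ρ : ℕ → ℝ) : Prop :=
  ∃ (D : DetectorSeq 𝒴 α) (ε : ℕ → ℝ), Achieves P₀ P₁ D ε ρ

/-!
A detector learns nothing about the change unless it takes a sample in the change window, since
the law of the observations outside of the window does not depend on the change
(`pathLaw_eq_of_dependsOn`). Both directions rest on counting such samples.

**Converse.** Let `m = A / 2`. Up to time `m`, the detector behaves as without any change as long
as the change comes after `m`, which has probability about `1 / 2`. Hence, if its sampling rate is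
at most `r` with high probability, then without any change it takes, with high probability, at most
`r (A + n)` samples by time `m` (`mul_earlySamples_le`). Each sample lies in at most `n` of the
windows `[j, j + n)`, so only a fraction of order `n r = o(1)` of the windows that lie before `m`
is hit (`sum_hitSet_le`). A missed change has no effect: the detector keeps behaving as without any
change (`one_sub_le_changeLaw`). If, moreover, false alarms are rare, then without any change the
detector stops after time `m` with high probability (`mul_stop_le`), so that the delay is of order
`A` when the change point is at most `A / 4` (`le_of_detectionDelay_le`).

**Achievability.** The detector `scanDetector` starts a test at every multiple of `Δ`, where
`1 / ρ n ≪ Δ ≪ n`. A test samples consecutive times. After a warm-up of `a` samples, it is given up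
as soon as the observations are at least as likely under `P₀` as under `P₁`. It decides for a
change if after `l` samples the likelihood ratio reaches `2 ^ θ`, with `θ` slightly larger than `α n` and `l` slightly
larger than `θ / D(P₁‖P₀)`. Bounds of Chernoff type (`pathLaw_real_le_of_le_prod`) show the rest.
A test on `P₀` passes with probability at most `2 ^ (-θ)`, so the at most `A + n` tests cause no
false alarm (`pathLaw_scanStop_lt_le`). By the Bhattacharyya bound, a test on `P₀` takes `a + O(1)`
samples on average, which is negligible compared to `Δ * ρ n` (`pathLaw_scanSamples_le`), and a test
on `P₁` is given up with a probability that is exponentially small in `a`. Therefore the first test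
after the change succeeds, at a delay of at most `Δ + l ∼ n α / D(P₁‖P₀)`
(`pathLaw_lt_scanStop_le`). Tests are run independently of each other, even where they overlap, so
that a test which is in progress at the change point does no harm.
-/

/-! ### Adaptive sampling sets -/

section Adaptive

variable {𝒴 : Type*} {N : ℕ}

/-- Whether `t` is sampled is decided by the samples taken before `t`. This is a reformulation of
`IsAdaptive` that refers to sampling times instead of positions in the list of samples. -/
def IsNonanticipating (S : (ObsTime N → 𝒴) → Finset (ObsTime N)) : Prop :=
  ∀ (y y' : ObsTime N → 𝒴) (t : ObsTime N), t ∈ S y → (∀ s ∈ S y, s < t → y' s = y s) → t ∈ S y'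

lemma mem_samplingTimes {s : Finset (ObsTime N)} {t : ObsTime N} :
    t ∈ samplingTimes s ↔ t ∈ s := by
  simp [samplingTimes]

lemma pairwise_lt_samplingTimes (s : Finset (ObsTime N)) :
    (samplingTimes s).Pairwise (· < ·) :=
  (Finset.sortedLT_sort s).pairwise

lemma IsAdaptive.isNonanticipating {S : (ObsTime N → 𝒴) → Finset (ObsTime N)}
    (hS : IsAdaptive S) : IsNonanticipating S := by
  obtain ⟨g, hg⟩ := hS
  intro y y' t ht hy
  obtain ⟨i, hi, rfl⟩ := List.getElem_of_mem (mem_samplingTimes.2 ht)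
  set L := samplingTimes (S y) with hL
  set L' := samplingTimes (S y') with hL'
  have hmap : ∀ j ≤ i, (L.take j).map y' = (L.take j).map y := by
    intro j hj
    refine List.map_congr_left fun s hs => ?_
    obtain ⟨k, hk, rfl⟩ := List.mem_take_iff_getElem.1 hs
    have hki : k < i := by omega
    exact hy _ (mem_samplingTimes.1 (List.getElem_mem _))
      (List.pairwise_iff_getElem.1 (pairwise_lt_samplingTimes (S y)) k i _ hi hki)
  have htake : ∀ j ≤ i, L.take j = L'.take j := by
    intro j
    induction j with
    | zero => simp
    | succ j ih =>
      intro hj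
      rw [List.take_add_one, List.take_add_one, hg y j, hg y' j, ← hL, ← hL', ← ih (by omega),
        hmap j (by omega)]
  have h : L'[i]? = some L[i] := by
    have h' : L'[i]? = L[i]? := by
      rw [hg y' i, ← hL', ← htake i le_rfl, hmap i le_rfl, hL, ← hg y i]
    rw [h', List.getElem?_eq_getElem hi]
  exact mem_samplingTimes.1 (List.mem_of_getElem? h)

/-- If two paths have the same first `i` sampling times, with the same values there, then the
next sampling time for one path is preceded or met by a sampling time for the other. -/
lemma IsNonanticipating.exists_le_getElem? {S : (ObsTime N → 𝒴) → Finset (ObsTime N)}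
    (hS : IsNonanticipating S) {y y' : ObsTime N → 𝒴} {i : ℕ}
    (htake : (samplingTimes (S y)).take i = (samplingTimes (S y')).take i)
    (hy : ∀ s ∈ (samplingTimes (S y)).take i, y' s = y s) {t : ObsTime N}
    (ht : (samplingTimes (S y))[i]? = some t) :
    ∃ t' ≤ t, (samplingTimes (S y'))[i]? = some t' := by
  obtain ⟨hi, rfl⟩ := List.getElem?_eq_some_iff.1 ht
  set L := samplingTimes (S y) with hL
  have hsort := List.pairwise_iff_getElem.1 (pairwise_lt_samplingTimes (S y))
  have hmem : L[i] ∈ S y' := by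
    refine hS y y' _ (mem_samplingTimes.1 (List.getElem_mem hi)) fun s hs hst => hy s ?_
    obtain ⟨k, hk, rfl⟩ := List.getElem_of_mem (mem_samplingTimes.2 hs)
    refine List.mem_take_iff_getElem.2 ⟨k, ?_, rfl⟩
    have : k < i := by
      by_contra hik
      rcases (not_lt.1 hik).eq_or_lt with h | h
      · subst h; exact lt_irrefl _ hst
      · exact lt_asymm hst (hsort i k hi hk h)
    omega
  obtain ⟨k, hk, hkt⟩ := List.getElem_of_mem (mem_samplingTimes.2 hmem)
  have hik : i ≤ k := by
    by_contra hki
    have hk' : L[k]? = some L[i] := by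
      have h1 : (L.take i)[k]? = ((samplingTimes (S y')).take i)[k]? := by rw [htake]
      rw [List.getElem?_take_of_lt (by omega), List.getElem?_take_of_lt (by omega)] at h1
      rw [h1, List.getElem?_eq_getElem hk, hkt]
    obtain ⟨hk2, hk3⟩ := List.getElem?_eq_some_iff.1 hk'
    exact (hsort k i hk2 hi (by omega)).ne hk3
  refine ⟨(samplingTimes (S y'))[i]'(by omega), ?_, List.getElem?_eq_getElem _⟩
  rw [← hkt]
  rcases hik.eq_or_lt with h | h
  · subst h; exact le_rfl
  · exact (List.pairwise_iff_getElem.1 (pairwise_lt_samplingTimes (S y')) i k _ hk h).le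

lemma IsNonanticipating.isAdaptive {S : (ObsTime N → 𝒴) → Finset (ObsTime N)}
    (hS : IsNonanticipating S) : IsAdaptive S := by
  have step : ∀ (y y' : ObsTime N → 𝒴) (i : ℕ),
      (samplingTimes (S y)).take i = (samplingTimes (S y')).take i →
      (∀ s ∈ (samplingTimes (S y)).take i, y' s = y s) →
      (samplingTimes (S y))[i]? = (samplingTimes (S y'))[i]? := by
    intro y y' i htake hy
    have hy' : ∀ s ∈ (samplingTimes (S y')).take i, y s = y' s := by
      intro s hs
      rw [← htake] at hs
      exact (hy s hs).symm
    rcases h : (samplingTimes (S y))[i]? with _ | t <;>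
      rcases h' : (samplingTimes (S y'))[i]? with _ | t'
    · rfl
    · obtain ⟨u, -, hu⟩ := hS.exists_le_getElem? htake.symm hy' h'
      simp [h] at hu
    · obtain ⟨u, -, hu⟩ := hS.exists_le_getElem? htake hy h
      simp [h'] at hu
    · obtain ⟨u, hut, hu⟩ := hS.exists_le_getElem? htake.symm hy' h'
      obtain ⟨v, hvt, hv⟩ := hS.exists_le_getElem? htake hy h
      rw [h] at hu
      rw [h'] at hv
      cases hu
      cases hv
      rw [le_antisymm hut hvt]
  have pre : ∀ (y y' : ObsTime N → 𝒴) (k : ℕ),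
      ((samplingTimes (S y)).take k).map y = ((samplingTimes (S y')).take k).map y' →
      (samplingTimes (S y)).take k = (samplingTimes (S y')).take k ∧
        ∀ s ∈ (samplingTimes (S y)).take k, y' s = y s := by
    intro y y' k hk
    have htake : ∀ i ≤ k, (samplingTimes (S y)).take i = (samplingTimes (S y')).take i ∧
        ∀ s ∈ (samplingTimes (S y)).take i, y' s = y s := by
      intro i
      induction i with
      | zero => simp
      | succ i ih =>
        intro hi
        obtain ⟨h1, h2⟩ := ih (by omega)
        have h3 := step y y' i h1 h2
        have h4 : (samplingTimes (S y)).take (i + 1) = (samplingTimes (S y')).take (i + 1) := by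
          rw [List.take_add_one, List.take_add_one, h1, h3]
        refine ⟨h4, fun s hs => ?_⟩
        have h5 : ((samplingTimes (S y)).take (i + 1)).map y =
            ((samplingTimes (S y)).take (i + 1)).map y' := by
          have := congrArg (List.take (i + 1)) hk
          rw [← List.map_take, ← List.map_take, List.take_take, List.take_take,
            min_eq_left hi] at this
          rw [this, h4]
        exact (List.map_inj_left.1 h5 s hs).symm
    exact htake k le_rfl
  have main : ∀ (y y' : ObsTime N → 𝒴) (j j' : ℕ),
      ((samplingTimes (S y)).take j).map y = ((samplingTimes (S y')).take j').map y' →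
      (samplingTimes (S y))[j]? = (samplingTimes (S y'))[j']? := by
    intro y y' j j' h
    have hlen := congrArg List.length h
    simp only [List.length_map, List.length_take] at hlen
    have norm : ∀ (l : List (ObsTime N)) (i : ℕ), l[i]? = l[min i l.length]? ∧
        l.take i = l.take (min i l.length) := by
      intro l i
      rcases le_total i l.length with hi | hi
      · rw [min_eq_left hi]; exact ⟨rfl, rfl⟩
      · rw [min_eq_right hi]; simp [hi]
    rw [(norm _ j).2, (norm _ j').2, ← hlen] at h
    rw [(norm _ j).1, (norm _ j').1, ← hlen]
    obtain ⟨h1, h2⟩ := pre y y' _ h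
    exact step y y' _ h1 h2
  classical
  refine ⟨fun l => if h : ∃ p : (ObsTime N → 𝒴) × ℕ, ((samplingTimes (S p.1)).take p.2).map p.1 = l
    then (samplingTimes (S h.choose.1))[h.choose.2]? else none, fun y j => ?_⟩
  have h : ∃ p : (ObsTime N → 𝒴) × ℕ, ((samplingTimes (S p.1)).take p.2).map p.1 =
      ((samplingTimes (S y)).take j).map y := ⟨(y, j), rfl⟩
  refine Eq.trans ?_ (dif_pos h).symm
  exact main _ _ _ _ h.choose_spec.symm

/-- A path determines its samples up to time `T` through their values only. -/
lemma IsNonanticipating.mem_iff {S : (ObsTime N → 𝒴) → Finset (ObsTime N)}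
    (hS : IsNonanticipating S) {y y' : ObsTime N → 𝒴} {T : ℕ}
    (hy : ∀ s ∈ S y, s.1 ≤ T → y' s = y s) (t : ObsTime N) (ht : t.1 ≤ T) :
    t ∈ S y ↔ t ∈ S y' := by
  induction t using WellFoundedLT.induction with
  | ind t ih =>
    constructor
    · exact fun h => hS y y' t h fun s hs hst => hy s hs ((Subtype.coe_lt_coe.2 hst).le.trans ht)
    · refine fun h => hS y' y t h fun s hs hst => ?_
      have hsT : s.1 ≤ T := (Subtype.coe_lt_coe.2 hst).le.trans ht
      exact (hy s ((ih s hst hsT).2 hs) hsT).symm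

end Adaptive

/-! ### The law of a path and the joint law -/

section Detector

variable {𝒴 : Type*} {A n : ℕ} (D : Detector 𝒴 (horizon A n))

lemma measurableSet_mem_S (y : ObsTime (horizon A n) → 𝒴) (s : Finset (ObsTime (horizon A n))) :
    MeasurableSet {r | D.S r y = s} := by
  have : {r | D.S r y = s} = ⋂ t, {r | t ∈ D.S r y ↔ t ∈ s} := by
    ext r; simp [Finset.ext_iff]
  rw [this]
  refine MeasurableSet.iInter fun t => ?_
  by_cases h : t ∈ s
  · simpa [h] using D.measurable_S y t
  · simp only [h, iff_false]
    exact (D.measurable_S y t).compl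

/-- An event is measurable once it is expressed through the sampling set and the stopping time. -/
lemma measurableSet_seed (y : ObsTime (horizon A n) → 𝒴)
    (p : Finset (ObsTime (horizon A n)) → ObsTime (horizon A n) → Prop) :
    MeasurableSet {r | p (D.S r y) (D.τ r y)} := by
  have : {r | p (D.S r y) (D.τ r y)} =
      ⋃ (s) (t) (_ : p s t), {r | D.S r y = s} ∩ {r | D.τ r y = t} := by
    ext r
    simp only [Set.mem_iUnion]
    exact ⟨fun h => ⟨_, _, h, rfl, rfl⟩, by rintro ⟨s, t, h, rfl, rfl⟩; exact h⟩
  rw [this]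
  exact MeasurableSet.iUnion fun s => MeasurableSet.iUnion fun t => MeasurableSet.iUnion fun _ =>
    (measurableSet_mem_S D y s).inter (D.measurable_τ y t)

end Detector

section Laws

variable {𝒴 : Type*} [MeasurableSpace 𝒴]

/-- Two product laws with the same factors at the coordinates in `p` agree on the events that
are determined by these coordinates. -/
lemma pi_eq_of_dependsOn {ι : Type*} [Fintype ι] {α : ι → Type*} [∀ i, MeasurableSpace (α i)]
    [∀ i, DiscreteMeasurableSpace (α i)] [∀ i, Finite (α i)]
    (μ ν : ∀ i, Measure (α i)) [∀ i, IsProbabilityMeasure (μ i)] [∀ i, IsProbabilityMeasure (ν i)]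
    (p : ι → Prop) (h : ∀ i, p i → μ i = ν i) {E : Set (∀ i, α i)}
    (hE : ∀ y y', (∀ i, p i → y' i = y i) → y ∈ E → y' ∈ E) :
    Measure.pi μ E = Measure.pi ν E := by
  classical
  have key : ∀ (κ : ∀ i, Measure (α i)) [∀ i, IsProbabilityMeasure (κ i)], Measure.pi κ E =
      Measure.pi (fun i : Subtype p => κ i) {z | ∃ y ∈ E, ∀ i : Subtype p, z i = y i} := by
    intro κ _
    have hE' : E = (MeasurableEquiv.piEquivPiSubtypeProd α p) ⁻¹'
        ({z | ∃ y ∈ E, ∀ i : Subtype p, z i = y i} ×ˢ Set.univ) := by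
      ext y
      simp only [Set.mem_preimage, Set.mem_prod, Set.mem_ofPred_eq, Set.mem_univ, and_true]
      constructor
      · exact fun hy => ⟨y, hy, fun _ => rfl⟩
      · rintro ⟨y', hy', h'⟩
        exact hE y' y (fun i hi => h' ⟨i, hi⟩) hy'
    conv_lhs => rw [hE']
    rw [(measurePreserving_piEquivPiSubtypeProd κ p).measure_preimage
      (MeasurableSet.of_discrete.nullMeasurableSet), Measure.prod_prod]
    simp
  rw [key μ, key ν]
  congr 2
  ext i : 1
  exact h i i.2

instance isProbabilityMeasure_pathLaw (P₀ P₁ : PMF 𝒴) (N n j : ℕ) :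
    IsProbabilityMeasure (pathLaw P₀ P₁ N n j) := by
  unfold pathLaw
  have : ∀ t : ObsTime N, IsProbabilityMeasure
      (if j ≤ t.1 ∧ t.1 < j + n then P₁.toMeasure else P₀.toMeasure) := by
    intro t; split_ifs <;> infer_instance
  infer_instance

variable [Fintype 𝒴] [DiscreteMeasurableSpace 𝒴]

/-- The change is invisible to the events that are determined by the observations outside of the
change window: they have the same probability as without any change (a window of length `0`). -/
lemma pathLaw_eq_of_dependsOn (P₀ P₁ : PMF 𝒴) {N n j : ℕ} {E : Set (ObsTime N → 𝒴)}
    (hE : ∀ y y', (∀ t : ObsTime N, ¬ (j ≤ t.1 ∧ t.1 < j + n) → y' t = y t) → y ∈ E → y' ∈ E) :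
    pathLaw P₀ P₁ N n j E = pathLaw P₀ P₁ N 0 0 E := by
  unfold pathLaw
  have h1 : ∀ t : ObsTime N, IsProbabilityMeasure
      (if j ≤ t.1 ∧ t.1 < j + n then P₁.toMeasure else P₀.toMeasure) := by
    intro t; split_ifs <;> infer_instance
  have h2 : ∀ t : ObsTime N, IsProbabilityMeasure
      (if 0 ≤ t.1 ∧ t.1 < 0 + 0 then P₁.toMeasure else P₀.toMeasure) := by
    intro t; split_ifs <;> infer_instance
  refine pi_eq_of_dependsOn _ _ (fun t : ObsTime N => ¬ (j ≤ t.1 ∧ t.1 < j + n)) ?_ hE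
  intro t ht
  rw [if_neg ht, if_neg (by omega)]

variable (P₀ P₁ : PMF 𝒴) {A n : ℕ} (D : Detector 𝒴 (horizon A n))

/-- The joint law of the observations and of the seed, for the change window `[j, j + m)`. -/
noncomputable def changeLaw (m j : ℕ) : Measure ((ObsTime (horizon A n) → 𝒴) × D.Seed) :=
  (pathLaw P₀ P₁ (horizon A n) m j).prod D.seedLaw

instance (m j : ℕ) : IsProbabilityMeasure (changeLaw P₀ P₁ D m j) := by
  unfold changeLaw; infer_instance

/-- Since the path space is countable, measurability of an event may be checked path by path. -/
lemma measurableSet_of_sections {X R : Type*} [Countable X] [MeasurableSpace X]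
    [MeasurableSingletonClass X] [MeasurableSpace R] {E : Set (X × R)}
    (hE : ∀ x, MeasurableSet {r | (x, r) ∈ E}) : MeasurableSet E := by
  have : E = ⋃ x, {x} ×ˢ {r | (x, r) ∈ E} := by
    ext ⟨x, r⟩; simp
  rw [this]
  exact MeasurableSet.iUnion fun x => (measurableSet_singleton x).prod (hE x)

lemma changeLaw_eq_of_dependsOn {m j : ℕ} {E : Set ((ObsTime (horizon A n) → 𝒴) × D.Seed)}
    (hE : ∀ y, MeasurableSet {r | (y, r) ∈ E})
    (hdep : ∀ r y y', (∀ t : ObsTime (horizon A n), ¬ (j ≤ t.1 ∧ t.1 < j + m) → y' t = y t) →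
      (y, r) ∈ E → (y', r) ∈ E) :
    (changeLaw P₀ P₁ D m j).real E = (changeLaw P₀ P₁ D 0 0).real E := by
  unfold changeLaw
  have hm := measurableSet_of_sections hE
  rw [measureReal_def, measureReal_def, Measure.prod_apply_symm hm, Measure.prod_apply_symm hm]
  congr 2
  ext r
  exact pathLaw_eq_of_dependsOn P₀ P₁ (hdep r)

/-- Conditioning on the change point. -/
lemma jointLaw_real_eq (hA : 1 ≤ A) {E : Set (Outcome D)}
    (hE : ∀ j y, MeasurableSet {r | (j, (y, r)) ∈ E}) :
    (jointLaw P₀ P₁ D).real E =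
      (A : ℝ)⁻¹ * ∑ j ∈ Finset.Icc 1 A, (changeLaw P₀ P₁ D n j).real {x | (j, x) ∈ E} := by
  have hm : MeasurableSet E :=
    measurableSet_of_sections fun j => measurableSet_of_sections fun y => hE j y
  unfold jointLaw
  rw [measureReal_def, Measure.finsetSum_apply, ENNReal.toReal_sum, Finset.mul_sum]
  · refine Finset.sum_congr rfl fun j _ => ?_
    rw [Measure.smul_apply, Measure.dirac_prod, Measure.map_apply measurable_prodMk_left hm,
      smul_eq_mul, ENNReal.toReal_mul, ENNReal.toReal_inv, ENNReal.toReal_natCast]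
    rfl
  · intro j _
    rw [Measure.smul_apply, smul_eq_mul]
    refine ENNReal.mul_ne_top ?_ (measure_ne_top _ _)
    simp; omega

lemma isProbabilityMeasure_jointLaw (hA : 1 ≤ A) : IsProbabilityMeasure (jointLaw P₀ P₁ D) := by
  have h : (jointLaw P₀ P₁ D).real Set.univ = 1 := by
    rw [jointLaw_real_eq P₀ P₁ D hA (by simp)]
    have hA' : (A : ℝ) ≠ 0 := by positivity
    simp [hA']
  refine ⟨?_⟩
  rw [measureReal_def] at h
  exact (ENNReal.toReal_eq_one_iff _).1 h

end Laws

/-! ### What the samples taken so far determine -/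

section Determined

variable {𝒴 : Type*} {A n : ℕ} (D : Detector 𝒴 (horizon A n))

/-- The samples taken up to the stopping time, for given observations and seed. -/
def takenSamples (x : (ObsTime (horizon A n) → 𝒴) × D.Seed) : Finset (ObsTime (horizon A n)) :=
  (D.S x.2 x.1).filter (· ≤ D.τ x.2 x.1)

/-- The samples taken up to the stopping time and up to time `m`. -/
def earlySamples (m : ℕ) (x : (ObsTime (horizon A n) → 𝒴) × D.Seed) :
    Finset (ObsTime (horizon A n)) :=
  (takenSamples D x).filter (·.1 ≤ m)

/-- A detector cannot tell apart two paths that agree at the samples it takes. -/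
lemma Detector.congr_of_takenSamples {r : D.Seed} {y y' : ObsTime (horizon A n) → 𝒴}
    (h : ∀ s ∈ takenSamples D (y, r), y' s = y s) :
    D.τ r y' = D.τ r y ∧ takenSamples D (y', r) = takenSamples D (y, r) := by
  have hτ : D.τ r y' = D.τ r y :=
    D.stopping r y y' fun s hs hsτ => h s (Finset.mem_filter.2 ⟨hs, hsτ⟩)
  refine ⟨hτ, ?_⟩
  ext t
  simp only [takenSamples, Finset.mem_filter, hτ]
  refine and_congr_left fun ht => ?_
  exact ((D.adaptive r).isNonanticipating.mem_iff (T := (D.τ r y).1)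
    (fun s hs hsT => h s (Finset.mem_filter.2 ⟨hs, hsT⟩)) t ht).symm

lemma Detector.τ_eq_of_agree {r : D.Seed} {y y' : ObsTime (horizon A n) → 𝒴} {m : ℕ}
    (h : ∀ t : ObsTime (horizon A n), t.1 ≤ m → y' t = y t) (hm : (D.τ r y).1 ≤ m) :
    D.τ r y' = D.τ r y :=
  D.stopping r y y' fun s _ hsτ => h s (le_trans (Subtype.coe_le_coe.2 hsτ) hm)

lemma earlySamples_eq_of_agree {r : D.Seed} {y y' : ObsTime (horizon A n) → 𝒴} {m : ℕ}
    (h : ∀ t : ObsTime (horizon A n), t.1 ≤ m → y' t = y t) :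
    earlySamples D m (y', r) = earlySamples D m (y, r) := by
  have key : ∀ {y y' : ObsTime (horizon A n) → 𝒴},
      (∀ t : ObsTime (horizon A n), t.1 ≤ m → y' t = y t) →
      earlySamples D m (y, r) ⊆ earlySamples D m (y', r) := by
    intro y y' h t ht
    simp only [earlySamples, takenSamples, Finset.mem_filter] at ht ⊢
    obtain ⟨⟨htS, htτ⟩, htm⟩ := ht
    refine ⟨⟨((D.adaptive r).isNonanticipating.mem_iff (T := m)
      (fun s _ hs => h s hs) t htm).1 htS, ?_⟩, htm⟩
    by_contra hlt
    have hm : (D.τ r y').1 ≤ m := le_trans (Subtype.coe_le_coe.2 (not_le.1 hlt).le) htm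
    rw [← D.τ_eq_of_agree (fun t ht => (h t ht).symm) hm] at hlt
    exact hlt htτ
  exact Finset.Subset.antisymm (key fun t ht => (h t ht).symm) (key h)

/-- The detector takes a sample in the change window `[j, j + n)`. -/
def hitSet (j : ℕ) : Set ((ObsTime (horizon A n) → 𝒴) × D.Seed) :=
  {x | ∃ s ∈ takenSamples D x, j ≤ s.1 ∧ s.1 < j + n}

lemma measurableSet_of_takenSamples [Finite 𝒴] [MeasurableSpace 𝒴] [DiscreteMeasurableSpace 𝒴]
    (p : Finset (ObsTime (horizon A n)) → ℕ → Prop) :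
    MeasurableSet {x : (ObsTime (horizon A n) → 𝒴) × D.Seed |
      p (takenSamples D x) (D.τ x.2 x.1)} :=
  measurableSet_of_sections fun y =>
    measurableSet_seed D y fun s t => p (s.filter (· ≤ t)) t

end Determined

/-! ### Sparse sampling misses the change -/

section Converse

/-- A bound for a sum of probabilities, from a bound for the number of events that occur. -/
lemma sum_measureReal_le {Ω ι : Type*} [MeasurableSpace Ω] (μ : Measure Ω)
    [IsProbabilityMeasure μ] (s : Finset ι) {E : ι → Set Ω} (hE : ∀ j, MeasurableSet (E j))
    {B : Set Ω} (hB : MeasurableSet B) {a b : ℝ}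
    (h : ∀ ω, ∑ j ∈ s, (E j).indicator (1 : Ω → ℝ) ω ≤ a + b * B.indicator (1 : Ω → ℝ) ω) :
    ∑ j ∈ s, μ.real (E j) ≤ a + b * μ.real B := by
  have hint : ∀ {F : Set Ω}, MeasurableSet F → Integrable (F.indicator (1 : Ω → ℝ)) μ :=
    fun hF => (integrable_const (1 : ℝ)).indicator hF
  calc ∑ j ∈ s, μ.real (E j) = ∫ ω, ∑ j ∈ s, (E j).indicator (1 : Ω → ℝ) ω ∂μ := by
        rw [integral_finsetSum _ fun j _ => hint (hE j)]
        exact Finset.sum_congr rfl fun j _ => (integral_indicator_one (hE j)).symm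
    _ ≤ ∫ ω, (a + b * B.indicator (1 : Ω → ℝ) ω) ∂μ :=
        integral_mono (integrable_finsetSum _ fun j _ => hint (hE j))
          ((integrable_const a).add ((hint hB).const_mul b)) h
    _ = a + b * μ.real B := by
        rw [integral_add (integrable_const a) ((hint hB).const_mul b), integral_const_mul,
          integral_indicator_one hB]
        simp

variable {𝒴 : Type*} [MeasurableSpace 𝒴] [Fintype 𝒴] [DiscreteMeasurableSpace 𝒴]
  (P₀ P₁ : PMF 𝒴) {A n : ℕ} (D : Detector 𝒴 (horizon A n))

lemma measurableSet_hitSet (j : ℕ) : MeasurableSet (hitSet D j) :=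
  measurableSet_of_takenSamples D fun s _ => ∃ t ∈ s, j ≤ t.1 ∧ t.1 < j + n

/-- Without a change, few samples before time `m` can hit only few of the windows `[j, j + n)`. -/
lemma sum_hitSet_le {m J : ℕ} (hJm : J + n ≤ m + 1) {K : ℝ} (hK : 0 ≤ K) :
    ∑ j ∈ Finset.Icc 1 J, (changeLaw P₀ P₁ D 0 0).real (hitSet D j) ≤
      n * K + J * (changeLaw P₀ P₁ D 0 0).real {x | K < (earlySamples D m x).card} := by
  classical
  refine sum_measureReal_le _ _ (measurableSet_hitSet D)
    (measurableSet_of_takenSamples D fun s _ => K < ((s.filter (·.1 ≤ m)).card : ℝ)) fun x => ?_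
  have hcount : ∑ j ∈ Finset.Icc 1 J, (hitSet D j).indicator
      (1 : (ObsTime (horizon A n) → 𝒴) × D.Seed → ℝ) x =
      (((Finset.Icc 1 J).filter fun j => x ∈ hitSet D j).card : ℝ) := by
    rw [Finset.card_filter]
    push_cast
    exact Finset.sum_congr rfl fun j _ => by simp [Set.indicator_apply]
  rw [hcount]
  by_cases hx : K < (earlySamples D m x).card
  · rw [Set.indicator_of_mem (by exact hx)]
    have h1 : (((Finset.Icc 1 J).filter fun j => x ∈ hitSet D j).card : ℝ) ≤ J := by
      have := Finset.card_filter_le (Finset.Icc 1 J) fun j => x ∈ hitSet D j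
      rw [Nat.card_Icc] at this
      exact_mod_cast this
    have h2 : 0 ≤ n * K := by positivity
    simp only [Pi.one_apply, mul_one]
    linarith
  · rw [Set.indicator_of_notMem (by exact hx)]
    -- a sample at time `s` hits only the windows that start in `(s - n, s]`
    have hsub : ((Finset.Icc 1 J).filter fun j => x ∈ hitSet D j) ⊆
        (earlySamples D m x).biUnion fun s => Finset.Ioc (s.1 - n) s.1 := by
      intro j hj
      obtain ⟨hjJ, s, hs, hjs, hsj⟩ := Finset.mem_filter.1 hj
      rw [Finset.mem_Icc] at hjJ
      refine Finset.mem_biUnion.2 ⟨s, Finset.mem_filter.2 ⟨hs, by omega⟩, ?_⟩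
      rw [Finset.mem_Ioc]
      omega
    have h1 : ((Finset.Icc 1 J).filter fun j => x ∈ hitSet D j).card ≤
        (earlySamples D m x).card * n :=
      (Finset.card_le_card hsub).trans <| Finset.card_biUnion_le_card_mul _ _ _ fun s _ => by
        rw [Nat.card_Ioc]; omega
    have h2 : (((Finset.Icc 1 J).filter fun j => x ∈ hitSet D j).card : ℝ) ≤
        (earlySamples D m x).card * n := by exact_mod_cast h1
    have h3 : ((earlySamples D m x).card : ℝ) ≤ K := not_lt.1 hx
    have h4 : ((earlySamples D m x).card : ℝ) * n ≤ K * n := by gcongr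
    linarith

/-- Averaging over the change points in `(m, A]` only. -/
lemma mul_le_jointLaw (hA : 1 ≤ A) {m : ℕ} (hm : m ≤ A) {E : Set (Outcome D)}
    (hE : ∀ j y, MeasurableSet {r | (j, (y, r)) ∈ E}) {c : ℝ}
    (h : ∀ j, m < j → j ≤ A → c ≤ (changeLaw P₀ P₁ D n j).real {x | (j, x) ∈ E}) :
    ((A : ℝ) - m) / A * c ≤ (jointLaw P₀ P₁ D).real E := by
  rw [jointLaw_real_eq P₀ P₁ D hA hE]
  have h1 : ∑ j ∈ Finset.Ioc m A, c ≤
      ∑ j ∈ Finset.Icc 1 A, (changeLaw P₀ P₁ D n j).real {x | (j, x) ∈ E} := by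
    refine (Finset.sum_le_sum fun j hj => ?_).trans
      (Finset.sum_le_sum_of_subset_of_nonneg (s := Finset.Ioc m A) ?_ fun _ _ _ => measureReal_nonneg)
    · rw [Finset.mem_Ioc] at hj
      exact h j hj.1 hj.2
    · intro j hj
      rw [Finset.mem_Ioc] at hj
      rw [Finset.mem_Icc]
      omega
  rw [Finset.sum_const, Nat.card_Ioc, nsmul_eq_mul, Nat.cast_sub hm] at h1
  rw [div_mul_eq_mul_div, div_eq_inv_mul]
  gcongr

/-- Averaging over the change points in `[1, J]` only. -/
lemma sum_le_jointLaw (hA : 1 ≤ A) {J : ℕ} (hJ : J ≤ A) {E : Set (Outcome D)}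
    (hE : ∀ j y, MeasurableSet {r | (j, (y, r)) ∈ E}) :
    (A : ℝ)⁻¹ * ∑ j ∈ Finset.Icc 1 J, (changeLaw P₀ P₁ D n j).real {x | (j, x) ∈ E} ≤
      (jointLaw P₀ P₁ D).real E := by
  rw [jointLaw_real_eq P₀ P₁ D hA hE]
  refine mul_le_mul_of_nonneg_left ?_ (by positivity)
  exact Finset.sum_le_sum_of_subset_of_nonneg (Finset.Icc_subset_Icc le_rfl hJ)
    fun _ _ _ => measureReal_nonneg

/-- A change after time `m` does not influence the samples taken up to time `m`. -/
lemma mul_earlySamples_le (hA : 1 ≤ A) {m : ℕ} (hm : m ≤ A) (K : ℝ) :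
    ((A : ℝ) - m) / A *
        (changeLaw P₀ P₁ D 0 0).real {x | K < (earlySamples D m x).card} ≤
      (jointLaw P₀ P₁ D).real {ω | K < (samplesTaken D ω).card} := by
  refine mul_le_jointLaw P₀ P₁ D hA hm
    (fun j y => measurableSet_seed D y fun s t => K < ((s.filter (· ≤ t)).card : ℝ))
    fun j hj _ => ?_
  rw [← changeLaw_eq_of_dependsOn P₀ P₁ D (m := n) (j := j)]
  · refine measureReal_mono fun x hx => ?_
    refine lt_of_lt_of_le (b := ((earlySamples D m x).card : ℝ)) hx ?_
    exact_mod_cast Finset.card_le_card (Finset.filter_subset _ _)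
  · exact fun y => measurableSet_seed D y fun s t =>
      K < (((s.filter (· ≤ t)).filter (·.1 ≤ m)).card : ℝ)
  · intro r y y' h hy
    have := earlySamples_eq_of_agree D (r := r) (m := m) fun t ht => h t (by omega)
    change K < ((earlySamples D m (y', r)).card : ℝ)
    rw [this]
    exact hy

/-- A change after time `m` does not influence whether the detector stops up to time `m`. -/
lemma mul_stop_le (hA : 1 ≤ A) {m : ℕ} (hm : m ≤ A) :
    ((A : ℝ) - m) / A *
        (changeLaw P₀ P₁ D 0 0).real {x | (D.τ x.2 x.1).1 ≤ m} ≤ falseAlarm P₀ P₁ D := by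
  refine mul_le_jointLaw P₀ P₁ D hA hm
    (fun j y => measurableSet_seed D y fun _ t => t.1 < j) fun j hj _ => ?_
  rw [← changeLaw_eq_of_dependsOn P₀ P₁ D (m := n) (j := j)]
  · exact measureReal_mono fun x hx => lt_of_le_of_lt (b := m) hx hj
  · exact fun y => measurableSet_seed D y fun _ t => t.1 ≤ m
  · intro r y y' h hy
    change (D.τ r y').1 ≤ m
    rw [D.τ_eq_of_agree (fun t ht => h t (by omega)) hy]
    exact hy

/-- A detector that does not hit the change window behaves as without any change. -/
lemma one_sub_le_changeLaw (p : ℕ → Prop) (j : ℕ) :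
    1 - (changeLaw P₀ P₁ D 0 0).real (hitSet D j) -
        (changeLaw P₀ P₁ D 0 0).real {x | ¬ p (D.τ x.2 x.1)} ≤
      (changeLaw P₀ P₁ D n j).real {x | p (D.τ x.2 x.1) ∧ x ∉ hitSet D j} := by
  rw [changeLaw_eq_of_dependsOn P₀ P₁ D (m := n) (j := j)
    (E := {x | p (D.τ x.2 x.1) ∧ x ∉ hitSet D j})]
  · have h1 := measurableSet_hitSet D j
    have h2 : MeasurableSet {x : (ObsTime (horizon A n) → 𝒴) × D.Seed | ¬ p (D.τ x.2 x.1)} :=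
      measurableSet_of_takenSamples D fun _ t => ¬ p t
    have h3 : {x : (ObsTime (horizon A n) → 𝒴) × D.Seed | p (D.τ x.2 x.1) ∧ x ∉ hitSet D j} =
        (hitSet D j ∪ {x | ¬ p (D.τ x.2 x.1)})ᶜ := by
      ext x
      simp only [Set.mem_compl_iff, Set.mem_union, not_or]
      change _ ↔ x ∉ hitSet D j ∧ ¬ ¬ p (D.τ x.2 x.1)
      rw [not_not]
      exact and_comm
    rw [h3, probReal_compl_eq_one_sub (h1.union h2)]
    have := measureReal_union_le (μ := changeLaw P₀ P₁ D 0 0) (hitSet D j)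
      {x | ¬ p (D.τ x.2 x.1)}
    linarith
  · exact fun y => measurableSet_seed D y fun s t =>
      p t ∧ ¬ ∃ u ∈ s.filter (· ≤ t), j ≤ u.1 ∧ u.1 < j + n
  · rintro r y y' h ⟨hy, hmiss⟩
    have hc := D.congr_of_takenSamples (r := r) (y := y) (y' := y') fun s hs =>
      h s fun hs' => hmiss ⟨s, hs, hs'⟩
    refine ⟨?_, ?_⟩
    · change p (D.τ r y')
      rw [hc.1]
      exact hy
    · rintro ⟨s, hs, hs'⟩
      rw [hc.2] at hs
      exact hmiss ⟨s, hs, hs'⟩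

/-- A detector of small sampling rate rarely takes more than `r * (A + n)` samples. -/
lemma jointLaw_many_samples_le (hA : 1 ≤ A) {ε r : ℝ} (hε : 0 ≤ ε)
    (hr : samplingRate P₀ P₁ D ε < r) :
    (jointLaw P₀ P₁ D).real {ω | r * (A + n) < (samplesTaken D ω).card} ≤ ε := by
  have := isProbabilityMeasure_jointLaw P₀ P₁ D hA
  have hτ : ∀ ω : Outcome D, 1 ≤ stopTime D ω ∧ stopTime D ω ≤ A + n := by
    intro ω
    have h1 := (D.τ ω.2.2 ω.2.1).2
    rw [Set.mem_Icc] at h1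
    exact ⟨h1.1, h1.2.trans (by unfold horizon; omega)⟩
  have hmeas : ∀ q : ℕ → ℕ → Prop,
      MeasurableSet {ω : Outcome D | q (samplesTaken D ω).card (stopTime D ω)} := fun q =>
    measurableSet_of_sections fun j => measurableSet_of_sections fun y =>
      measurableSet_seed D y fun s t => q (s.filter (· ≤ t)).card t.1
  obtain ⟨r', ⟨hr0, hr'⟩, hlt⟩ := exists_lt_of_csInf_lt (by
    refine ⟨horizon A n, by positivity, ?_⟩
    have : {ω : Outcome D | ((samplesTaken D ω).card : ℝ) / (stopTime D ω : ℝ) ≤ horizon A n} =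
        Set.univ := by
      refine Set.eq_univ_of_forall fun ω => ?_
      change ((samplesTaken D ω).card : ℝ) / (stopTime D ω : ℝ) ≤ horizon A n
      have h1 : (1 : ℝ) ≤ stopTime D ω := by exact_mod_cast (hτ ω).1
      have h2 : (samplesTaken D ω).card ≤ horizon A n :=
        (Finset.card_le_univ _).trans (by simp)
      calc ((samplesTaken D ω).card : ℝ) / (stopTime D ω : ℝ) ≤ (samplesTaken D ω).card :=
            div_le_self (by positivity) h1
        _ ≤ horizon A n := by exact_mod_cast h2
    rw [this, probReal_univ]
    linarith) hr
  have hsub : {ω : Outcome D | r * (A + n) < (samplesTaken D ω).card} ⊆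
      {ω | ((samplesTaken D ω).card : ℝ) / (stopTime D ω : ℝ) ≤ r'}ᶜ := by
    intro ω hω hω'
    have hω1 : r * (A + n) < (samplesTaken D ω).card := hω
    have hω2 : ((samplesTaken D ω).card : ℝ) / (stopTime D ω : ℝ) ≤ r' := hω'
    have h1 : (0 : ℝ) < stopTime D ω := by exact_mod_cast (hτ ω).1
    have h2 : (stopTime D ω : ℝ) ≤ A + n := by exact_mod_cast (hτ ω).2
    rw [div_le_iff₀ h1] at hω2
    nlinarith
  refine (measureReal_mono hsub).trans ?_
  rw [probReal_compl_eq_one_sub (hmeas fun c t => (c : ℝ) / (t : ℝ) ≤ r')]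
  linarith

/-- The windows `[j, j + n)` with `j ≤ J` are mostly missed. -/
lemma le_missProb (hA : 1 ≤ A) {m J : ℕ} (hJ : J ≤ A) (hJm : J + n ≤ m + 1) {K : ℝ}
    (hK : 0 ≤ K) :
    (J : ℝ) / A - n * K / A -
        (changeLaw P₀ P₁ D 0 0).real {x | K < (earlySamples D m x).card} ≤
      missProb P₀ P₁ D := by
  have hA' : (0 : ℝ) < A := by exact_mod_cast hA
  have hJ' : (J : ℝ) ≤ A := by exact_mod_cast hJ
  refine le_trans ?_ (sum_le_jointLaw P₀ P₁ D hA hJ fun j y => measurableSet_seed D y fun s t =>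
    ∀ u ∈ s.filter (· ≤ t), ¬ (j ≤ u.1 ∧ u.1 < j + n))
  have h1 : ∑ j ∈ Finset.Icc 1 J, (1 - (changeLaw P₀ P₁ D 0 0).real (hitSet D j)) ≤
      ∑ j ∈ Finset.Icc 1 J, (changeLaw P₀ P₁ D n j).real {x | (j, x) ∈
        {ω : Outcome D | ∀ s ∈ samplesTaken D ω, ¬ (ω.1 ≤ s.1 ∧ s.1 < ω.1 + n)}} := by
    refine Finset.sum_le_sum fun j _ => ?_
    refine (le_of_eq ?_).trans ((one_sub_le_changeLaw P₀ P₁ D (fun _ => True) j).trans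
      (measureReal_mono ?_))
    · simp
    · rintro x ⟨-, hx⟩ s hs hs'
      exact hx ⟨s, hs, hs'⟩
  have h2 := sum_hitSet_le P₀ P₁ D hJm hK
  rw [Finset.sum_sub_distrib, Finset.sum_const, Nat.card_Icc, nsmul_eq_mul, mul_one,
    Nat.add_sub_cancel] at h1
  set q := (changeLaw P₀ P₁ D 0 0).real {x | K < (earlySamples D m x).card}
  have hq : 0 ≤ q := measureReal_nonneg
  have h3 : (J : ℝ) * q ≤ A * q := by gcongr
  have h4 : (J : ℝ) / A - n * K / A - q = (A : ℝ)⁻¹ * (J - n * K - A * q) := by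
    field_simp
  rw [h4]
  gcongr
  linarith

/-- The minimum in the definition of the delay is attained, and it is at most the horizon plus
one. -/
lemma detectionDelay_spec (hA : 1 ≤ A) {ε : ℝ} (hε : 0 ≤ ε) :
    1 - ε ≤ (jointLaw P₀ P₁ D).real
      {ω | (stopTime D ω : ℤ) - (ω.1 : ℤ) ≤ (detectionDelay P₀ P₁ D ε : ℤ) - 1} ∧
    detectionDelay P₀ P₁ D ε ≤ horizon A n + 1 := by
  have := isProbabilityMeasure_jointLaw P₀ P₁ D hA
  have hmem : horizon A n + 1 ∈ {l : ℕ | 1 - ε ≤ (jointLaw P₀ P₁ D).real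
      {ω | (stopTime D ω : ℤ) - (ω.1 : ℤ) ≤ (l : ℤ) - 1}} := by
    have h : {ω : Outcome D | (stopTime D ω : ℤ) - (ω.1 : ℤ) ≤ ((horizon A n + 1 : ℕ) : ℤ) - 1} =
        Set.univ := by
      refine Set.eq_univ_of_forall fun ω => ?_
      change (stopTime D ω : ℤ) - (ω.1 : ℤ) ≤ ((horizon A n + 1 : ℕ) : ℤ) - 1
      have h1 : stopTime D ω ≤ horizon A n := (D.τ ω.2.2 ω.2.1).2.2
      omega
    change 1 - ε ≤ (jointLaw P₀ P₁ D).real _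
    rw [h, probReal_univ]
    linarith
  exact ⟨Nat.sInf_mem ⟨_, hmem⟩, Nat.sInf_le hmem⟩

/-- If the delay were at most `h`, then after missing the change the detector would have to stop
by time `m`, although the change point is not larger than `J`. -/
lemma le_of_detectionDelay_le (hA : 1 ≤ A) {m J h : ℕ} (hJ : J ≤ A) (hJm : J + n ≤ m + 1)
    (hh : J + h ≤ m + 1) {K : ℝ} (hK : 0 ≤ K) {ε : ℝ} (hε : 0 ≤ ε)
    (hd : detectionDelay P₀ P₁ D ε ≤ h) :
    (J : ℝ) / A ≤ ε + n * K / A +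
      (changeLaw P₀ P₁ D 0 0).real {x | K < (earlySamples D m x).card} +
      (changeLaw P₀ P₁ D 0 0).real {x | (D.τ x.2 x.1).1 ≤ m} := by
  have := isProbabilityMeasure_jointLaw P₀ P₁ D hA
  have hA' : (0 : ℝ) < A := by exact_mod_cast hA
  have hJ' : (J : ℝ) ≤ A := by exact_mod_cast hJ
  have hmem := (detectionDelay_spec P₀ P₁ D hA hε).1
  set E : Set (Outcome D) := {ω | (h : ℤ) ≤ (stopTime D ω : ℤ) - (ω.1 : ℤ)} with hEdef
  have hE : ∀ j y, MeasurableSet {r | (j, (y, r)) ∈ E} := fun j y =>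
    measurableSet_seed D y fun _ t => (h : ℤ) ≤ (t.1 : ℤ) - (j : ℤ)
  have hEm : MeasurableSet E :=
    measurableSet_of_sections fun j => measurableSet_of_sections fun y => hE j y
  have hEε : (jointLaw P₀ P₁ D).real E ≤ ε := by
    have h1 : (jointLaw P₀ P₁ D).real
        {ω | (stopTime D ω : ℤ) - (ω.1 : ℤ) ≤ (detectionDelay P₀ P₁ D ε : ℤ) - 1} ≤
        (jointLaw P₀ P₁ D).real Eᶜ := by
      refine measureReal_mono fun ω hω hω' => ?_
      have h2 : (stopTime D ω : ℤ) - (ω.1 : ℤ) ≤ (detectionDelay P₀ P₁ D ε : ℤ) - 1 := hω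
      have h3 : (h : ℤ) ≤ (stopTime D ω : ℤ) - (ω.1 : ℤ) := hω'
      omega
    rw [probReal_compl_eq_one_sub hEm] at h1
    linarith
  have h0 := (sum_le_jointLaw P₀ P₁ D hA hJ hE).trans hEε
  have h1 : ∑ j ∈ Finset.Icc 1 J, (1 - (changeLaw P₀ P₁ D 0 0).real (hitSet D j) -
        (changeLaw P₀ P₁ D 0 0).real {x | (D.τ x.2 x.1).1 ≤ m}) ≤
      ∑ j ∈ Finset.Icc 1 J, (changeLaw P₀ P₁ D n j).real {x | (j, x) ∈ E} := by
    refine Finset.sum_le_sum fun j hj => ?_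
    rw [Finset.mem_Icc] at hj
    refine (le_of_eq ?_).trans ((one_sub_le_changeLaw P₀ P₁ D (fun t => ¬ t ≤ m) j).trans
      (measureReal_mono ?_))
    · simp only [not_not]
    · rintro x ⟨hx, -⟩
      change (h : ℤ) ≤ ((D.τ x.2 x.1).1 : ℤ) - (j : ℤ)
      omega
  have h2 := sum_hitSet_le P₀ P₁ D hJm hK
  rw [Finset.sum_sub_distrib, Finset.sum_sub_distrib, Finset.sum_const, Finset.sum_const,
    Nat.card_Icc, nsmul_eq_mul, nsmul_eq_mul, mul_one, Nat.add_sub_cancel] at h1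
  set q := (changeLaw P₀ P₁ D 0 0).real {x | K < (earlySamples D m x).card}
  set f := (changeLaw P₀ P₁ D 0 0).real {x | (D.τ x.2 x.1).1 ≤ m}
  have hq : 0 ≤ q := measureReal_nonneg
  have hf : 0 ≤ f := measureReal_nonneg
  have h3 : (J : ℝ) * q ≤ A * q := by gcongr
  have h3' : (J : ℝ) * f ≤ A * f := by gcongr
  rw [inv_mul_le_iff₀ hA'] at h0
  have h4 : ε + n * K / A + q + f = (A * ε + n * K + A * q + A * f) / A := by
    field_simp
  rw [h4]
  gcongr
  linarith

end Converse

/-! ### Growth of the uncertainty level -/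

section Growth

variable {α : ℝ}

lemma one_le_uncertaintyLevel (hα : 0 < α) (n : ℕ) : 1 ≤ uncertaintyLevel α n :=
  Nat.one_le_floor_iff _ |>.2 (Real.one_le_rpow (by norm_num) (by positivity))

lemma uncertaintyLevel_le (α : ℝ) (n : ℕ) : (uncertaintyLevel α n : ℝ) ≤ 2 ^ (α * n) :=
  Nat.floor_le (by positivity)

lemma rpow_le_two_mul_uncertaintyLevel (hα : 0 < α) (n : ℕ) :
    (2 : ℝ) ^ (α * n) ≤ 2 * uncertaintyLevel α n := by
  have h1 : (2 : ℝ) ^ (α * n) < uncertaintyLevel α n + 1 := Nat.lt_floor_add_one _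
  have h2 : (1 : ℝ) ≤ uncertaintyLevel α n := by exact_mod_cast one_le_uncertaintyLevel hα n
  linarith

lemma tendsto_pow_div_uncertaintyLevel (hα : 0 < α) (k : ℕ) :
    Tendsto (fun n : ℕ => (n : ℝ) ^ k / uncertaintyLevel α n) atTop (𝓝 0) := by
  have hr : |(2 : ℝ) ^ (-α)| < 1 := by
    rw [abs_of_pos (by positivity)]
    exact Real.rpow_lt_one_of_one_lt_of_neg (by norm_num) (by linarith)
  have h := (tendsto_pow_const_mul_const_pow_of_abs_lt_one k hr).const_mul 2
  rw [mul_zero] at h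
  refine squeeze_zero (fun n => by positivity) (fun n => ?_) h
  have h1 : (0 : ℝ) < uncertaintyLevel α n := by exact_mod_cast one_le_uncertaintyLevel hα n
  have h2 : ((2 : ℝ) ^ (-α)) ^ n = ((2 : ℝ) ^ (α * n))⁻¹ := by
    rw [← Real.rpow_natCast, ← Real.rpow_mul (by norm_num), ← Real.rpow_neg (by norm_num)]
    ring_nf
  have h3 : (0 : ℝ) < 2 ^ (α * n) := by positivity
  rw [h2, div_le_iff₀ h1]
  have h4 := rpow_le_two_mul_uncertaintyLevel hα n
  calc (n : ℝ) ^ k = n ^ k * ((2 : ℝ) ^ (α * n))⁻¹ * 2 ^ (α * n) := by field_simp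
    _ ≤ n ^ k * ((2 : ℝ) ^ (α * n))⁻¹ * (2 * uncertaintyLevel α n) := by gcongr
    _ = 2 * (n ^ k * ((2 : ℝ) ^ (α * n))⁻¹) * uncertaintyLevel α n := by ring

lemma eventually_mul_le_uncertaintyLevel (hα : 0 < α) (c : ℝ) (k : ℕ) :
    ∀ᶠ n : ℕ in atTop, c * (n : ℝ) ^ k ≤ uncertaintyLevel α n := by
  filter_upwards [((tendsto_pow_div_uncertaintyLevel hα k).const_mul c).eventually_le_const
    (u := 1) (by simp)] with n hn
  have h1 : (0 : ℝ) < uncertaintyLevel α n := by exact_mod_cast one_le_uncertaintyLevel hα n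
  rwa [← mul_div_assoc, div_le_one h1] at hn

end Growth

/-! ### Asymptotics of the converse -/

section ConverseAsymptotics

variable {𝒴 : Type*} [MeasurableSpace 𝒴] [Fintype 𝒴] [DiscreteMeasurableSpace 𝒴]
  (P₀ P₁ : PMF 𝒴)

/-- With `m = A / 2`, `J = A / 4` and the sample budget `r * (A + n)`, both bounds for the effect
of sparse sampling have error terms of the orders of `n * r`, of `ε`, and of the false-alarm
probability. -/
lemma sparse_sampling_bounds {A n : ℕ} (D : Detector 𝒴 (horizon A n)) (hA : 12 ≤ A)
    (hnA : 4 * n ≤ A) {ε r : ℝ} (hε : 0 ≤ ε) (hr : samplingRate P₀ P₁ D ε < r) :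
    3 / 16 - 2 * (n * r) - 2 * ε ≤ missProb P₀ P₁ D ∧
    (detectionDelay P₀ P₁ D ε ≤ A / 4 →
      3 / 16 ≤ 2 * (n * r) + 3 * ε + 2 * falseAlarm P₀ P₁ D) := by
  have hA1 : 1 ≤ A := by omega
  have hA0 : (0 : ℝ) < A := by exact_mod_cast hA1
  have hr0 : 0 ≤ r := (Real.sInf_nonneg fun x hx => hx.1).trans hr.le
  have hK : 0 ≤ r * (A + n) := by positivity
  have hm : A / 2 ≤ A := by omega
  have half : ∀ {q c : ℝ}, 0 ≤ q → ((A : ℝ) - (A / 2 : ℕ)) / A * q ≤ c → q ≤ 2 * c := by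
    intro q c hq h
    have h1 : ((A / 2 : ℕ) : ℝ) ≤ A / 2 := Nat.cast_div_le
    have h2 : (1 : ℝ) / 2 ≤ ((A : ℝ) - (A / 2 : ℕ)) / A := by
      rw [div_le_div_iff₀ (by norm_num) hA0]
      linarith
    nlinarith
  have hB := half measureReal_nonneg
    ((mul_earlySamples_le P₀ P₁ D hA1 hm (r * (A + n))).trans
      (jointLaw_many_samples_le P₀ P₁ D hA1 hε hr))
  have hF := half measureReal_nonneg (mul_stop_le P₀ P₁ D hA1 hm)
  have hJ : (3 : ℝ) / 16 ≤ ((A / 4 : ℕ) : ℝ) / A := by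
    rw [div_le_div_iff₀ (by norm_num) hA0]
    have h1 : 3 * A ≤ (A / 4) * 16 := by omega
    exact_mod_cast h1
  have hnr : n * (r * (A + n)) / A ≤ 2 * (n * r) := by
    rw [div_le_iff₀ hA0]
    have h1 : (n : ℝ) ≤ A := by exact_mod_cast (by omega : n ≤ A)
    have h2 : n * r * n ≤ n * r * A := by gcongr
    nlinarith
  constructor
  · have h := le_missProb P₀ P₁ D hA1 (m := A / 2) (J := A / 4) (by omega) (by omega) hK
    linarith
  · intro hd
    have h := le_of_detectionDelay_le P₀ P₁ D hA1 (m := A / 2) (J := A / 4) (by omega) (by omega)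
      (by omega) hK hε hd
    linarith

variable {α : ℝ} {ρ : ℕ → ℝ}

/-- The extra `1 / n ^ 2` turns the bound `≤ ρ n` on the sampling rate, an infimum, into a strict
one without leaving the range `o(1 / n)`. -/
lemma tendsto_mul_add_of_isLittleO (hρ : ρ =o[atTop] (fun n : ℕ => 1 / (n : ℝ))) :
    Tendsto (fun n : ℕ => (n : ℝ) * (ρ n + 1 / (n : ℝ) ^ 2)) atTop (𝓝 0) := by
  have h1 := hρ.tendsto_div_nhds_zero
  have h2 := tendsto_one_div_atTop_nhds_zero_nat (𝕜 := ℝ)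
  have h3 := h1.add h2
  rw [add_zero] at h3
  refine h3.congr' ?_
  filter_upwards [eventually_gt_atTop 0] with n hn
  have : (n : ℝ) ≠ 0 := by positivity
  field_simp

lemma eventually_le_missProb (hα : 0 < α)
    (hρ : ρ =o[atTop] (fun n : ℕ => 1 / (n : ℝ)))
    (D : DetectorSeq 𝒴 α) (ε : ℕ → ℝ) (hε : IsVanishing ε)
    (hrate : ∀ᶠ n : ℕ in atTop, samplingRate P₀ P₁ (D n) (ε n) ≤ ρ n) :
    ∀ᶠ n : ℕ in atTop, 1 / 8 ≤ missProb P₀ P₁ (D n) := by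
  have hlim := ((tendsto_mul_add_of_isLittleO hρ).const_mul 2).add (hε.2.const_mul 2)
  rw [mul_zero, add_zero] at hlim
  filter_upwards [hrate, eventually_mul_le_uncertaintyLevel hα 4 1,
    eventually_mul_le_uncertaintyLevel hα 12 0, eventually_gt_atTop 0,
    hlim.eventually_le_const (u := 1 / 16) (by norm_num)] with n h1 h2 h3 h4 h5
  have h6 := (sparse_sampling_bounds P₀ P₁ (D n) (by exact_mod_cast (by simpa using h3))
    (by rw [pow_one] at h2; exact_mod_cast h2) (hε.1 n) (r := ρ n + 1 / (n : ℝ) ^ 2)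
    (lt_of_le_of_lt h1 (by simp; positivity))).1
  linarith

lemma detectionDelay_isTheta (hα : 0 < α)
    (hρ : ρ =o[atTop] (fun n : ℕ => 1 / (n : ℝ)))
    (D : DetectorSeq 𝒴 α) (ε : ℕ → ℝ) (hε : IsVanishing ε)
    (hrate : ∀ᶠ n : ℕ in atTop, samplingRate P₀ P₁ (D n) (ε n) ≤ ρ n)
    (hfa : Tendsto (fun n : ℕ => falseAlarm P₀ P₁ (D n)) atTop (𝓝 0)) :
    (fun n : ℕ => (detectionDelay P₀ P₁ (D n) (ε n) : ℝ)) =Θ[atTop]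
      (fun n : ℕ => (2 : ℝ) ^ (α * n)) := by
  have hlim := (((tendsto_mul_add_of_isLittleO hρ).const_mul 2).add (hε.2.const_mul 3)).add
    (hfa.const_mul 2)
  simp only [mul_zero, add_zero] at hlim
  constructor
  · refine IsBigO.of_bound 2 ?_
    filter_upwards [eventually_mul_le_uncertaintyLevel hα 4 1, eventually_gt_atTop 0] with n h2 h4
    have h5 := (detectionDelay_spec P₀ P₁ (D n) (one_le_uncertaintyLevel hα n) (hε.1 n)).2
    have h6 : (detectionDelay P₀ P₁ (D n) (ε n) : ℝ) ≤ uncertaintyLevel α n + n := by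
      unfold horizon at h5
      exact_mod_cast (by omega)
    have h7 := uncertaintyLevel_le α n
    rw [Real.norm_of_nonneg (by positivity), Real.norm_of_nonneg (by positivity)]
    have h8 : (0 : ℝ) ≤ n := by positivity
    rw [pow_one] at h2
    linarith
  · refine IsBigO.of_bound 8 ?_
    filter_upwards [hrate, eventually_mul_le_uncertaintyLevel hα 4 1,
      eventually_mul_le_uncertaintyLevel hα 12 0, eventually_gt_atTop 0,
      hlim.eventually_lt_const (u := 3 / 16) (by norm_num)] with n h1 h2 h3 h4 h5
    have h6 := (sparse_sampling_bounds P₀ P₁ (D n) (by exact_mod_cast (by simpa using h3))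
      (by rw [pow_one] at h2; exact_mod_cast h2) (hε.1 n) (r := ρ n + 1 / (n : ℝ) ^ 2)
      (lt_of_le_of_lt h1 (by simp; positivity))).2
    have h7 : ¬ detectionDelay P₀ P₁ (D n) (ε n) ≤ uncertaintyLevel α n / 4 := fun h => by
      linarith [h6 h]
    have h8 : uncertaintyLevel α n ≤ 4 * detectionDelay P₀ P₁ (D n) (ε n) := by omega
    have h9 : (uncertaintyLevel α n : ℝ) ≤ 4 * detectionDelay P₀ P₁ (D n) (ε n) := by
      exact_mod_cast h8
    have h10 := rpow_le_two_mul_uncertaintyLevel hα n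
    rw [Real.norm_of_nonneg (by positivity), Real.norm_of_nonneg (by positivity)]
    linarith

/-- A delay of exponential order contradicts a delay of subexponential order. -/
lemma not_isAchievable (hα : 0 < α)
    (hρ : ρ =o[atTop] (fun n : ℕ => 1 / (n : ℝ))) :
    ¬ IsAchievable P₀ P₁ α ρ := by
  rintro ⟨D, ε, hε, hach⟩
  have hfa : Tendsto (fun n : ℕ => falseAlarm P₀ P₁ (D n)) atTop (𝓝 0) :=
    squeeze_zero' (Eventually.of_forall fun n => measureReal_nonneg) (hach.mono fun n h => h.1)
      hε.2
  have hΘ := detectionDelay_isTheta P₀ P₁ hα hρ D ε hε (hach.mono fun n h => h.2.1) hfa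
  obtain ⟨c, hc, hle⟩ := hΘ.2.exists_pos
  have hlog : Tendsto (fun n : ℕ => 1 / (n : ℝ) * Real.logb 2 c + ε n) atTop (𝓝 0) := by
    have h := (tendsto_one_div_atTop_nhds_zero_nat (𝕜 := ℝ)).mul_const (Real.logb 2 c)
    rw [zero_mul] at h
    simpa using h.add hε.2
  obtain ⟨n, ⟨h1, h2⟩, h3, h4⟩ := ((hach.and hle.bound).and
    ((hlog.eventually_lt_const hα).and (eventually_gt_atTop 0))).exists
  rw [Real.norm_of_nonneg (by positivity), Real.norm_of_nonneg (by positivity)] at h2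
  have hd : 0 < (detectionDelay P₀ P₁ (D n) (ε n) : ℝ) := by
    by_contra hd
    have h5 : (0 : ℝ) < 2 ^ (α * n) := by positivity
    nlinarith
  have h6 : α * n ≤ Real.logb 2 c + Real.logb 2 (detectionDelay P₀ P₁ (D n) (ε n)) := by
    rw [← Real.logb_mul hc.ne' hd.ne', Real.le_logb_iff_rpow_le (by norm_num) (by positivity)]
    exact h2
  have hn : (0 : ℝ) < n := by exact_mod_cast h4
  have h7 : α ≤ 1 / n * Real.logb 2 c +
      1 / n * Real.logb 2 (detectionDelay P₀ P₁ (D n) (ε n)) := by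
    rw [← mul_add, one_div, ← div_eq_inv_mul, le_div_iff₀ hn]
    exact h6
  linarith [h1.2.2]

end ConverseAsymptotics

/-! ### Likelihoods of a window of observations -/

section Likelihood

variable {𝒴 : Type*} {N : ℕ}

/-- The times of the window `[u, u + m)` (as far as they belong to the time horizon). -/
def window (N u m : ℕ) : Finset (ObsTime N) :=
  Finset.univ.filter fun t => u ≤ t.1 ∧ t.1 < u + m

/-- The likelihood under `P` of the observations in the window `[u, u + m)`. -/
noncomputable def windowLik (P : PMF 𝒴) (y : ObsTime N → 𝒴) (u m : ℕ) : ℝ :=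
  ∏ t ∈ window N u m, (P (y t)).toReal

lemma mem_window {u m : ℕ} {t : ObsTime N} : t ∈ window N u m ↔ u ≤ t.1 ∧ t.1 < u + m := by
  simp [window]

lemma card_window {u m : ℕ} (hu : 1 ≤ u) (hm : u + m ≤ N + 1) : (window N u m).card = m := by
  have h : (window N u m).map (Function.Embedding.subtype _) = Finset.Ico u (u + m) := by
    ext t
    simp only [Finset.mem_map, Finset.mem_Ico, mem_window, Function.Embedding.coe_subtype]
    constructor
    · rintro ⟨t, ht, rfl⟩
      exact ht
    · intro ht
      exact ⟨⟨t, by omega, by omega⟩, ht, rfl⟩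
  rw [← Finset.card_map (Function.Embedding.subtype _), h, Nat.card_Ico]
  omega

lemma windowLik_congr (P : PMF 𝒴) {y y' : ObsTime N → 𝒴} {u m : ℕ}
    (h : ∀ t : ObsTime N, u ≤ t.1 → t.1 < u + m → y' t = y t) :
    windowLik P y' u m = windowLik P y u m :=
  Finset.prod_congr rfl fun t ht => by rw [h t (mem_window.1 ht).1 (mem_window.1 ht).2]

lemma toReal_pos_of_ne_zero {P : PMF 𝒴} {x : 𝒴} (h : P x ≠ 0) : 0 < (P x).toReal :=
  ENNReal.toReal_pos h (P.apply_ne_top x)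

lemma windowLik_pos {P : PMF 𝒴} {y : ObsTime N → 𝒴} {u m : ℕ}
    (h : ∀ t ∈ window N u m, P (y t) ≠ 0) : 0 < windowLik P y u m :=
  Finset.prod_pos fun t ht => toReal_pos_of_ne_zero (h t ht)

lemma prod_div_eq_windowLik (P Q : PMF 𝒴) (y : ObsTime N → 𝒴) (u m : ℕ) :
    ∏ t ∈ window N u m, (Q (y t)).toReal / (P (y t)).toReal =
      windowLik Q y u m / windowLik P y u m :=
  Finset.prod_div_distrib _ _

variable [Fintype 𝒴]

lemma sum_toReal_eq_one (P : PMF 𝒴) : ∑ x, (P x).toReal = 1 := by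
  have h := P.tsum_coe
  rw [tsum_fintype] at h
  rw [← ENNReal.toReal_sum fun x _ => P.apply_ne_top x, h, ENNReal.toReal_one]

/-- The Bhattacharyya coefficient of two distributions. -/
noncomputable def bhattacharyya (P Q : PMF 𝒴) : ℝ := ∑ x, √((P x).toReal * (Q x).toReal)

lemma bhattacharyya_comm (P Q : PMF 𝒴) : bhattacharyya P Q = bhattacharyya Q P := by
  simp only [bhattacharyya, mul_comm]

lemma bhattacharyya_nonneg (P Q : PMF 𝒴) : 0 ≤ bhattacharyya P Q :=
  Finset.sum_nonneg fun _ _ => Real.sqrt_nonneg _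

lemma bhattacharyya_lt_one {P Q : PMF 𝒴} (h : P ≠ Q) : bhattacharyya P Q < 1 := by
  obtain ⟨x, hx⟩ : ∃ x, P x ≠ Q x := by
    by_contra! hPQ
    exact h (PMF.ext hPQ)
  have hx' : (P x).toReal ≠ (Q x).toReal := fun hPQ =>
    hx ((ENNReal.toReal_eq_toReal_iff' (P.apply_ne_top x) (Q.apply_ne_top x)).1 hPQ)
  have h1 : 0 < ∑ x, (√(P x).toReal - √(Q x).toReal) ^ 2 := by
    refine Finset.sum_pos' (fun _ _ => sq_nonneg _) ⟨x, Finset.mem_univ x, ?_⟩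
    refine sq_pos_iff.2 fun h0 => hx' ?_
    exact (Real.sqrt_inj ENNReal.toReal_nonneg ENNReal.toReal_nonneg).1 (sub_eq_zero.1 h0)
  have h2 : ∑ x, (√(P x).toReal - √(Q x).toReal) ^ 2 = 2 - 2 * bhattacharyya P Q := by
    have h3 : ∀ x, (√(P x).toReal - √(Q x).toReal) ^ 2 =
        (P x).toReal + (Q x).toReal - 2 * √((P x).toReal * (Q x).toReal) := by
      intro x
      rw [sub_sq, Real.sq_sqrt ENNReal.toReal_nonneg, Real.sq_sqrt ENNReal.toReal_nonneg,
        Real.sqrt_mul ENNReal.toReal_nonneg]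
      ring
    simp_rw [h3]
    rw [Finset.sum_sub_distrib, Finset.sum_add_distrib, sum_toReal_eq_one, sum_toReal_eq_one,
      ← Finset.mul_sum, bhattacharyya]
    norm_num
  linarith

/-- The Laplace transform of the log-likelihood ratio under `P`, to second order at `0`. -/
lemma sum_mul_rpow_le {P Q : PMF 𝒴} (hac : ∀ x, Q x = 0 → P x = 0) {M s : ℝ}
    (hM : ∀ x, |Real.log ((Q x).toReal / (P x).toReal)| ≤ M) (hs : 0 ≤ s) (hsM : s * M ≤ 1) :
    ∑ x, (P x).toReal * ((Q x).toReal / (P x).toReal) ^ s ≤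
      Real.exp (-(s * (relEntropy P Q * Real.log 2)) + (s * M) ^ 2) := by
  have hterm : ∀ x, (P x).toReal * ((Q x).toReal / (P x).toReal) ^ s ≤
      (P x).toReal * (1 + (s * M) ^ 2) -
        s * ((P x).toReal * Real.logb 2 ((P x).toReal / (Q x).toReal) * Real.log 2) := by
    intro x
    by_cases hx : P x = 0
    · simp [hx]
    have hP : 0 < (P x).toReal := toReal_pos_of_ne_zero hx
    have hQ : 0 < (Q x).toReal := toReal_pos_of_ne_zero fun h => hx (hac x h)
    set z := Real.log ((Q x).toReal / (P x).toReal) with hz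
    have h1 : ((Q x).toReal / (P x).toReal) ^ s = Real.exp (s * z) := by
      rw [Real.rpow_def_of_pos (by positivity), mul_comm]
    have h2 : Real.logb 2 ((P x).toReal / (Q x).toReal) * Real.log 2 = -z := by
      rw [Real.logb, div_mul_cancel₀ _ (Real.log_pos (by norm_num)).ne', hz, ← Real.log_inv,
        inv_div]
    have habs : |s * z| ≤ s * M := by
      rw [abs_mul, abs_of_nonneg hs]
      exact mul_le_mul_of_nonneg_left (hM x) hs
    have h3 := (abs_le.1 (Real.abs_exp_sub_one_sub_id_le (habs.trans hsM))).2
    have h4 : (s * z) ^ 2 ≤ (s * M) ^ 2 := by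
      rw [← sq_abs (s * z)]
      gcongr
    have h5 : Real.exp (s * z) ≤ 1 + (s * M) ^ 2 + s * z := by linarith
    rw [h1, mul_assoc, h2]
    nlinarith
  calc ∑ x, (P x).toReal * ((Q x).toReal / (P x).toReal) ^ s
      ≤ ∑ x, ((P x).toReal * (1 + (s * M) ^ 2) -
        s * ((P x).toReal * Real.logb 2 ((P x).toReal / (Q x).toReal) * Real.log 2)) :=
        Finset.sum_le_sum fun x _ => hterm x
    _ = -(s * (relEntropy P Q * Real.log 2)) + (s * M) ^ 2 + 1 := by
        rw [Finset.sum_sub_distrib, ← Finset.sum_mul, sum_toReal_eq_one, ← Finset.mul_sum,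
          ← Finset.sum_mul, relEntropy]
        ring
    _ ≤ _ := Real.add_one_le_exp _

variable [MeasurableSpace 𝒴] [DiscreteMeasurableSpace 𝒴]

/-- Chernoff's method for a product statistic of a window in which all observations have
law `Q`. -/
lemma pathLaw_real_le_of_le_prod (P₀ P₁ Q : PMF 𝒴) {n j u m : ℕ} (hu : 1 ≤ u)
    (hm : u + m ≤ N + 1)
    (hQ : ∀ t : ObsTime N, u ≤ t.1 → t.1 < u + m →
      (if j ≤ t.1 ∧ t.1 < j + n then P₁ else P₀) = Q)
    {h : 𝒴 → ℝ} (hh : ∀ x, 0 ≤ h x) {c : ℝ} (hc : 0 < c) {E : Set (ObsTime N → 𝒴)}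
    (hE : ∀ y ∈ E, (∀ t ∈ window N u m, Q (y t) ≠ 0) → c ≤ ∏ t ∈ window N u m, h (y t)) :
    (pathLaw P₀ P₁ N n j).real E ≤ c⁻¹ * (∑ x, (Q x).toReal * h x) ^ m := by
  classical
  have hprob : ∀ t : ObsTime N, IsProbabilityMeasure
      (if j ≤ t.1 ∧ t.1 < j + n then P₁.toMeasure else P₀.toMeasure) := by
    intro t; split_ifs <;> infer_instance
  have hlaw : ∀ t ∈ window N u m,
      (if j ≤ t.1 ∧ t.1 < j + n then P₁.toMeasure else P₀.toMeasure) = Q.toMeasure := by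
    intro t ht
    rw [← hQ t (mem_window.1 ht).1 (mem_window.1 ht).2]
    split_ifs <;> rfl
  have hint : ∫ y, ∏ t ∈ window N u m, h (y t) ∂(pathLaw P₀ P₁ N n j) =
      (∑ x, (Q x).toReal * h x) ^ m := by
    have h1 : ∀ y : ObsTime N → 𝒴, ∏ t ∈ window N u m, h (y t) =
        ∏ t, (fun (t : ObsTime N) x => if t ∈ window N u m then h x else 1) t (y t) := by
      intro y
      rw [Finset.prod_ite_mem, Finset.univ_inter]
    simp_rw [h1]
    unfold pathLaw
    refine (integral_fintype_prod_eq_prod (fun t x => if t ∈ window N u m then h x else 1)).trans ?_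
    have h2 : ∀ t : ObsTime N, ∫ x, (if t ∈ window N u m then h x else 1)
        ∂(if j ≤ t.1 ∧ t.1 < j + n then P₁.toMeasure else P₀.toMeasure) =
        if t ∈ window N u m then ∑ x, (Q x).toReal * h x else 1 := by
      intro t
      by_cases ht : t ∈ window N u m
      · simp only [ht, if_true]
        rw [hlaw t ht, PMF.integral_eq_sum]
        simp
      · simp [ht]
    simp_rw [h2]
    rw [Finset.prod_ite_mem, Finset.univ_inter, Finset.prod_const, card_window hu hm]
  have hae : ∀ᵐ y ∂(pathLaw P₀ P₁ N n j), ∀ t ∈ window N u m, Q (y t) ≠ 0 := by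
    rw [ae_iff_of_countable]
    intro y hy t ht hzero
    refine hy ?_
    unfold pathLaw
    rw [Measure.pi_singleton]
    refine Finset.prod_eq_zero (Finset.mem_univ t) ?_
    rw [hlaw t ht, PMF.toMeasure_apply_singleton _ _ (measurableSet_singleton _), hzero]
  have hmono : (pathLaw P₀ P₁ N n j) E ≤
      (pathLaw P₀ P₁ N n j) {y | c ≤ ∏ t ∈ window N u m, h (y t)} :=
    measure_mono_ae (hae.mono fun y hy hyE => hE y hyE hy)
  have hmarkov := mul_meas_ge_le_integral_of_nonneg (μ := pathLaw P₀ P₁ N n j)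
    (f := fun y => ∏ t ∈ window N u m, h (y t))
    (Eventually.of_forall fun y => Finset.prod_nonneg fun t _ => hh _) .of_finite c
  rw [hint] at hmarkov
  have hmono' : (pathLaw P₀ P₁ N n j).real E ≤
      (pathLaw P₀ P₁ N n j).real {y | c ≤ ∏ t ∈ window N u m, h (y t)} :=
    ENNReal.toReal_mono (measure_ne_top _ _) hmono
  rw [inv_mul_eq_div, le_div_iff₀ hc, mul_comm]
  exact (mul_le_mul_of_nonneg_left hmono' hc.le).trans hmarkov

/-- Two distributions are confused over a window of length `m` with a probability that decays
exponentially in `m`. -/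
lemma pathLaw_windowLik_le (P₀ P₁ P Q : PMF 𝒴) {n j u m : ℕ} (hu : 1 ≤ u) (hm : u + m ≤ N + 1)
    (hP : ∀ t : ObsTime N, u ≤ t.1 → t.1 < u + m →
      (if j ≤ t.1 ∧ t.1 < j + n then P₁ else P₀) = P) :
    (pathLaw P₀ P₁ N n j).real {y | windowLik P y u m ≤ windowLik Q y u m} ≤
      bhattacharyya P Q ^ m := by
  have hsum : ∑ x, (P x).toReal * √((Q x).toReal / (P x).toReal) = bhattacharyya P Q := by
    refine Finset.sum_congr rfl fun x _ => ?_
    by_cases hx : (P x).toReal = 0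
    · simp [hx]
    · rw [Real.sqrt_div' _ ENNReal.toReal_nonneg, Real.sqrt_mul ENNReal.toReal_nonneg]
      have h1 : 0 < √(P x).toReal :=
        Real.sqrt_pos.2 (lt_of_le_of_ne ENNReal.toReal_nonneg (Ne.symm hx))
      rw [mul_div_assoc', div_eq_iff h1.ne']
      nth_rewrite 1 [← Real.mul_self_sqrt (ENNReal.toReal_nonneg (a := P x))]
      ring
  have h := pathLaw_real_le_of_le_prod P₀ P₁ P hu hm hP
    (h := fun x => √((Q x).toReal / (P x).toReal)) (fun _ => Real.sqrt_nonneg _) one_pos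
    (E := {y | windowLik P y u m ≤ windowLik Q y u m}) (fun y hy hpos => by
      have h1 : (∏ t ∈ window N u m, √((Q (y t)).toReal / (P (y t)).toReal)) ^ 2 =
          windowLik Q y u m / windowLik P y u m := by
        rw [← prod_div_eq_windowLik, ← Finset.prod_pow]
        exact Finset.prod_congr rfl fun t _ => Real.sq_sqrt (by positivity)
      have h2 : 1 ≤ windowLik Q y u m / windowLik P y u m := by
        rw [one_le_div (windowLik_pos hpos)]
        exact hy
      rw [← h1] at h2
      exact (one_le_sq_iff₀ (Finset.prod_nonneg fun _ _ => Real.sqrt_nonneg _)).1 h2)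
  rwa [hsum, inv_one, one_mul] at h

/-- Under `P`, the likelihood ratio exceeds `c` with probability at most `1 / c`. -/
lemma pathLaw_mul_windowLik_le (P₀ P₁ P Q : PMF 𝒴) {n j u m : ℕ} (hu : 1 ≤ u)
    (hm : u + m ≤ N + 1)
    (hP : ∀ t : ObsTime N, u ≤ t.1 → t.1 < u + m →
      (if j ≤ t.1 ∧ t.1 < j + n then P₁ else P₀) = P) {c : ℝ} (hc : 0 < c) :
    (pathLaw P₀ P₁ N n j).real {y | c * windowLik P y u m ≤ windowLik Q y u m} ≤ c⁻¹ := by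
  have hsum : ∑ x, (P x).toReal * ((Q x).toReal / (P x).toReal) ≤ 1 := by
    rw [← sum_toReal_eq_one Q]
    refine Finset.sum_le_sum fun x _ => ?_
    by_cases hx : (P x).toReal = 0
    · simp [hx]
    · rw [mul_div_cancel₀ _ hx]
  have h := pathLaw_real_le_of_le_prod P₀ P₁ P hu hm hP
    (h := fun x => (Q x).toReal / (P x).toReal) (fun _ => by positivity) hc
    (E := {y | c * windowLik P y u m ≤ windowLik Q y u m}) (fun y hy hpos => by
      rw [prod_div_eq_windowLik, le_div_iff₀ (windowLik_pos hpos)]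
      exact hy)
  refine h.trans ?_
  have h0 : 0 ≤ ∑ x, (P x).toReal * ((Q x).toReal / (P x).toReal) :=
    Finset.sum_nonneg fun _ _ => by positivity
  have h1 := pow_le_one₀ (n := m) h0 hsum
  nlinarith [inv_pos.2 hc]

/-- Chernoff's bound: under `P`, the log-likelihood ratio of a window of length `m` is rarely
below a level that is smaller than its mean `m * relEntropy P Q`. -/
lemma pathLaw_windowLik_lt_mul_le (P₀ P₁ : PMF 𝒴) {P Q : PMF 𝒴}
    (hac : ∀ x, Q x = 0 → P x = 0) {n j u m : ℕ}
    (hu : 1 ≤ u) (hm : u + m ≤ N + 1)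
    (hP : ∀ t : ObsTime N, u ≤ t.1 → t.1 < u + m →
      (if j ≤ t.1 ∧ t.1 < j + n then P₁ else P₀) = P) {θ M s : ℝ}
    (hM : ∀ x, |Real.log ((Q x).toReal / (P x).toReal)| ≤ M) (hs : 0 ≤ s) (hsM : s * M ≤ 1) :
    (pathLaw P₀ P₁ N n j).real {y | windowLik P y u m < 2 ^ θ * windowLik Q y u m} ≤
      Real.exp (-(s * Real.log 2 * (m * relEntropy P Q - θ)) + m * (s * M) ^ 2) := by
  have hc : (0 : ℝ) < ((2 : ℝ) ^ θ)⁻¹ ^ s := by positivity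
  have h := pathLaw_real_le_of_le_prod P₀ P₁ P hu hm hP
    (h := fun x => ((Q x).toReal / (P x).toReal) ^ s) (fun _ => by positivity) hc
    (E := {y | windowLik P y u m < 2 ^ θ * windowLik Q y u m}) (fun y hy hpos => by
      rw [Real.finsetProd_rpow _ _ fun _ _ => by positivity, prod_div_eq_windowLik]
      refine Real.rpow_le_rpow (by positivity) ?_ hs
      have hy' : windowLik P y u m < 2 ^ θ * windowLik Q y u m := hy
      rw [inv_eq_one_div, div_le_div_iff₀ (by positivity) (windowLik_pos hpos)]
      linarith)
  refine h.trans ?_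
  have h1 : (((2 : ℝ) ^ θ)⁻¹ ^ s)⁻¹ = Real.exp (s * Real.log 2 * θ) := by
    rw [Real.inv_rpow (by positivity), inv_inv, ← Real.rpow_mul (by norm_num),
      Real.rpow_def_of_pos (by norm_num)]
    ring_nf
  rw [h1]
  have h0 : 0 ≤ ∑ x, (P x).toReal * ((Q x).toReal / (P x).toReal) ^ s :=
    Finset.sum_nonneg fun _ _ => by positivity
  calc Real.exp (s * Real.log 2 * θ) * (∑ x, (P x).toReal * ((Q x).toReal / (P x).toReal) ^ s) ^ m
      ≤ Real.exp (s * Real.log 2 * θ) *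
        Real.exp (-(s * (relEntropy P Q * Real.log 2)) + (s * M) ^ 2) ^ m := by
        gcongr
        exact sum_mul_rpow_le hac hM hs hsM
    _ = _ := by
        rw [← Real.exp_nat_mul, ← Real.exp_add]
        congr 1
        ring

end Likelihood

/-! ### The scanning detector -/

section Scan

variable {𝒴 : Type*} {N : ℕ} (P₀ P₁ : PMF 𝒴) (Δ a l : ℕ) (c : ℝ)

/-- The test that starts at time `u` goes on after `m` samples: from the `a`-th sample on, the
observations have always been more likely under `P₁` than under `P₀`. -/
def TestAlive (y : ObsTime N → 𝒴) (u m : ℕ) : Prop :=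
  ∀ k, a ≤ k → k ≤ m → windowLik P₀ y u k < windowLik P₁ y u k

/-- The scanning detector samples at time `t`. A test of `l` consecutive samples starts at every
positive multiple of `Δ`, and is given up as soon as it is not alive any more. Overlapping tests
run independently of each other and share their samples. -/
def IsScanned (y : ObsTime N → 𝒴) (t : ObsTime N) : Prop :=
  ∃ u, 1 ≤ u ∧ Δ ∣ u ∧ u ≤ t.1 ∧ t.1 < u + l ∧ TestAlive P₀ P₁ a y u (t.1 - u)

/-- A test that ends at time `t` decides in favour of the change: it is alive after its `l`
samples, and its likelihood ratio is at least `c`. -/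
def ScanFires (y : ObsTime N → 𝒴) (t : ObsTime N) : Prop :=
  ∃ u, 1 ≤ u ∧ Δ ∣ u ∧ t.1 + 1 = u + l ∧ TestAlive P₀ P₁ a y u l ∧
    c * windowLik P₀ y u l ≤ windowLik P₁ y u l

open Classical in
/-- The sampling set of the scanning detector. -/
noncomputable def scanSamples (y : ObsTime N → 𝒴) : Finset (ObsTime N) :=
  Finset.univ.filter (IsScanned P₀ P₁ Δ a l y)

open Classical in
/-- The stopping time of the scanning detector: the first time at which a test decides in favour
of the change, or the end of the time horizon if no test does. -/
noncomputable def scanStop (hN : 1 ≤ N) (y : ObsTime N → 𝒴) : ObsTime N :=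
  (insert (⟨N, hN, le_rfl⟩ : ObsTime N)
    (Finset.univ.filter (ScanFires P₀ P₁ Δ a l c y))).min' (Finset.insert_nonempty _ _)

variable {P₀ P₁ Δ a l c}

lemma TestAlive.mono {y : ObsTime N → 𝒴} {u m m' : ℕ} (h : TestAlive P₀ P₁ a y u m)
    (hm : m' ≤ m) : TestAlive P₀ P₁ a y u m' := fun k hak hk => h k hak (hk.trans hm)

lemma TestAlive.congr {y y' : ObsTime N → 𝒴} {u m : ℕ} (h : TestAlive P₀ P₁ a y u m)
    (hy : ∀ t : ObsTime N, u ≤ t.1 → t.1 < u + m → y' t = y t) : TestAlive P₀ P₁ a y' u m := by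
  intro k hak hk
  rw [windowLik_congr P₀ fun t h1 h2 => hy t h1 (by omega),
    windowLik_congr P₁ fun t h1 h2 => hy t h1 (by omega)]
  exact h k hak hk

lemma mem_scanSamples {y : ObsTime N → 𝒴} {t : ObsTime N} :
    t ∈ scanSamples P₀ P₁ Δ a l y ↔ IsScanned P₀ P₁ Δ a l y t := by
  simp [scanSamples]

lemma mem_scanSamples_of_testAlive {y : ObsTime N → 𝒴} {u m : ℕ} (hu : 1 ≤ u) (hΔ : Δ ∣ u)
    (hm : m ≤ l) (h : TestAlive P₀ P₁ a y u m) {t : ObsTime N} (ht : u ≤ t.1)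
    (htm : t.1 < u + m) : t ∈ scanSamples P₀ P₁ Δ a l y :=
  mem_scanSamples.2 ⟨u, hu, hΔ, ht, by omega, h.mono (by omega)⟩

variable (P₀ P₁ Δ a l c)

lemma isNonanticipating_scanSamples :
    IsNonanticipating (scanSamples (N := N) P₀ P₁ Δ a l) := by
  intro y y' t ht hy
  obtain ⟨u, hu, hΔ, hut, htl, halive⟩ := mem_scanSamples.1 ht
  refine mem_scanSamples.2 ⟨u, hu, hΔ, hut, htl, halive.congr fun s hs hst => hy s ?_ ?_⟩
  · exact mem_scanSamples_of_testAlive hu hΔ (by omega) halive hs hst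
  · exact Subtype.coe_lt_coe.1 (by omega)

variable {P₀ P₁ Δ a l c}

lemma ScanFires.congr {y y' : ObsTime N → 𝒴} {t : ObsTime N} (h : ScanFires P₀ P₁ Δ a l c y t)
    (hy : ∀ s ∈ scanSamples P₀ P₁ Δ a l y, s ≤ t → y' s = y s) :
    ScanFires P₀ P₁ Δ a l c y' t := by
  obtain ⟨u, hu, hΔ, hut, halive, hlik⟩ := h
  have hagree : ∀ s : ObsTime N, u ≤ s.1 → s.1 < u + l → y' s = y s := fun s hs hst =>
    hy s (mem_scanSamples_of_testAlive hu hΔ le_rfl halive hs hst)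
      (Subtype.coe_le_coe.1 (by omega))
  refine ⟨u, hu, hΔ, hut, halive.congr hagree, ?_⟩
  rw [windowLik_congr P₀ hagree, windowLik_congr P₁ hagree]
  exact hlik

lemma scanStop_le_of_fires (hN : 1 ≤ N) {y : ObsTime N → 𝒴} {t : ObsTime N}
    (h : ScanFires P₀ P₁ Δ a l c y t) : scanStop P₀ P₁ Δ a l c hN y ≤ t := by
  classical
  exact Finset.min'_le _ _ (Finset.mem_insert_of_mem (by simpa using h))

lemma scanStop_eq_or_fires (hN : 1 ≤ N) (y : ObsTime N → 𝒴) :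
    (scanStop P₀ P₁ Δ a l c hN y).1 = N ∨
      ScanFires P₀ P₁ Δ a l c y (scanStop P₀ P₁ Δ a l c hN y) := by
  classical
  have h := Finset.min'_mem (insert (⟨N, hN, le_rfl⟩ : ObsTime N)
    (Finset.univ.filter (ScanFires P₀ P₁ Δ a l c y))) (Finset.insert_nonempty _ _)
  rcases Finset.mem_insert.1 h with h | h
  · exact Or.inl (congrArg Subtype.val h)
  · exact Or.inr (Finset.mem_filter.1 h).2

variable (P₀ P₁ Δ a l c)

lemma isSampledStoppingTime_scanStop (hN : 1 ≤ N) :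
    IsSampledStoppingTime (scanSamples P₀ P₁ Δ a l) (scanStop P₀ P₁ Δ a l c hN) := by
  intro y y' hy
  have hmem := (isNonanticipating_scanSamples P₀ P₁ Δ a l).mem_iff
    (y := y) (y' := y') (T := (scanStop P₀ P₁ Δ a l c hN y).1) hy
  have key : ∀ {z z' : ObsTime N → 𝒴},
      (∀ s ∈ scanSamples P₀ P₁ Δ a l z, s ≤ scanStop P₀ P₁ Δ a l c hN z → z' s = z s) →
      scanStop P₀ P₁ Δ a l c hN z' ≤ scanStop P₀ P₁ Δ a l c hN z := by
    intro z z' h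
    rcases scanStop_eq_or_fires hN z with hz | hz
    · rw [← Subtype.coe_le_coe, hz]
      exact (scanStop P₀ P₁ Δ a l c hN z').2.2
    · exact scanStop_le_of_fires hN (hz.congr h)
  refine le_antisymm (key hy) (key fun s hs hsτ => ?_)
  have hsT := hsτ.trans (key hy)
  exact (hy s ((hmem s hsT).2 hs) hsT).symm

/-- The scanning detector, which uses no randomization. -/
noncomputable def scanDetector (hN : 1 ≤ N) : Detector 𝒴 N where
  Seed := Unit
  seedLaw := Measure.dirac ()
  S _ := scanSamples P₀ P₁ Δ a l
  τ _ := scanStop P₀ P₁ Δ a l c hN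
  measurable_S _ _ := MeasurableSet.of_discrete
  measurable_τ _ _ := MeasurableSet.of_discrete
  adaptive _ := (isNonanticipating_scanSamples P₀ P₁ Δ a l).isAdaptive
  stopping _ := isSampledStoppingTime_scanStop P₀ P₁ Δ a l c hN

end Scan

/-! ### Performance of the scanning detector for a given change point -/

section ScanPerformance

variable {𝒴 : Type*} [MeasurableSpace 𝒴] [Fintype 𝒴] [DiscreteMeasurableSpace 𝒴]
  {N : ℕ} (P₀ P₁ : PMF 𝒴) (Δ a l : ℕ) (c : ℝ)

/-- A false alarm requires one of at most `N` tests on `P₀`-samples to decide for the change. -/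
lemma pathLaw_scanStop_lt_le (hN : 1 ≤ N) {n j : ℕ} (hj : j ≤ N) (hc : 0 < c) :
    (pathLaw P₀ P₁ N n j).real {y | (scanStop P₀ P₁ Δ a l c hN y).1 < j} ≤ N * c⁻¹ := by
  have hsub : {y : ObsTime N → 𝒴 | (scanStop P₀ P₁ Δ a l c hN y).1 < j} ⊆
      ⋃ u ∈ (Finset.Icc 1 N).filter (fun u => u + l ≤ j),
        {y | c * windowLik P₀ y u l ≤ windowLik P₁ y u l} := by
    intro y hy
    have hy' : (scanStop P₀ P₁ Δ a l c hN y).1 < j := hy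
    rcases scanStop_eq_or_fires (P₀ := P₀) (P₁ := P₁) (Δ := Δ) (a := a) (l := l) (c := c) hN y
      with h | ⟨u, hu, -, hul, -, hlik⟩
    · omega
    · refine Set.mem_biUnion (x := u) ?_ hlik
      simp only [Finset.coe_filter, Finset.mem_Icc, Set.mem_ofPred_eq]
      omega
  refine (measureReal_mono hsub (measure_ne_top _ _)).trans
    ((measureReal_biUnion_finset_le _ _).trans ?_)
  calc ∑ u ∈ (Finset.Icc 1 N).filter (fun u => u + l ≤ j),
        (pathLaw P₀ P₁ N n j).real {y | c * windowLik P₀ y u l ≤ windowLik P₁ y u l}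
      ≤ ∑ u ∈ (Finset.Icc 1 N).filter (fun u => u + l ≤ j), c⁻¹ := by
        refine Finset.sum_le_sum fun u hu => ?_
        rw [Finset.mem_filter, Finset.mem_Icc] at hu
        exact pathLaw_mul_windowLik_le P₀ P₁ P₀ P₁ hu.1.1 (by omega)
          (fun t h1 h2 => if_neg (by omega)) hc
    _ ≤ N * c⁻¹ := by
        rw [Finset.sum_const, nsmul_eq_mul]
        have : ((Finset.Icc 1 N).filter (fun u => u + l ≤ j)).card ≤ N := by
          simpa using Finset.card_filter_le (Finset.Icc 1 N) (fun u => u + l ≤ j)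
        gcongr

/-- The first test that starts after the change point detects the change, unless it is given up
or ends with a small likelihood ratio. -/
lemma pathLaw_lt_scanStop_le (hN : 1 ≤ N) (hac : ∀ x, P₀ x = 0 → P₁ x = 0) {n j : ℕ}
    (hj : 1 ≤ j) (hjN : j + n ≤ N + 1)
    (hΔ : 1 ≤ Δ) (hl : 1 ≤ l) (hn : Δ + l ≤ n) (hβ : bhattacharyya P₀ P₁ < 1) {θ M s : ℝ}
    (hM : ∀ x, |Real.log ((P₀ x).toReal / (P₁ x).toReal)| ≤ M) (hs : 0 ≤ s) (hsM : s * M ≤ 1) :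
    (pathLaw P₀ P₁ N n j).real
      {y | j + Δ + l < (scanStop P₀ P₁ Δ a l (2 ^ θ) hN y).1 + 2} ≤
      bhattacharyya P₀ P₁ ^ a / (1 - bhattacharyya P₀ P₁) +
        Real.exp (-(s * Real.log 2 * (l * relEntropy P₁ P₀ - θ)) + l * (s * M) ^ 2) := by
  obtain ⟨u, hju, huΔ, hdvd⟩ : ∃ u, j ≤ u ∧ u < j + Δ ∧ Δ ∣ u := by
    refine ⟨Δ * ((j + Δ - 1) / Δ), ?_, ?_, dvd_mul_right _ _⟩
    · have h1 := Nat.div_add_mod (j + Δ - 1) Δ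
      have h2 := Nat.mod_lt (j + Δ - 1) (by omega : 0 < Δ)
      omega
    · have h1 := Nat.mul_div_le (j + Δ - 1) Δ
      omega
  have hwin : ∀ k ≤ l, ∀ t : ObsTime N, u ≤ t.1 → t.1 < u + k →
      (if j ≤ t.1 ∧ t.1 < j + n then P₁ else P₀) = P₁ := fun k hk t h1 h2 =>
    if_pos ⟨by omega, by omega⟩
  have hsub : {y : ObsTime N → 𝒴 | j + Δ + l < (scanStop P₀ P₁ Δ a l (2 ^ θ) hN y).1 + 2} ⊆
      (⋃ k ∈ Finset.Ico a (l + 1), {y | windowLik P₁ y u k ≤ windowLik P₀ y u k}) ∪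
        {y | windowLik P₁ y u l < 2 ^ θ * windowLik P₀ y u l} := by
    intro y hy
    by_contra hno
    simp only [Set.mem_union, Set.mem_iUnion, not_or, not_exists] at hno
    obtain ⟨h1, h2⟩ := hno
    have halive : TestAlive P₀ P₁ a y u l := fun k hak hk =>
      not_le.1 (h1 k (Finset.mem_Ico.2 ⟨hak, by omega⟩))
    have hfire : ScanFires P₀ P₁ Δ a l (2 ^ θ) y ⟨u + l - 1, by omega, by omega⟩ :=
      ⟨u, by omega, hdvd, by change u + l - 1 + 1 = u + l; omega, halive, not_lt.1 h2⟩
    have hle : (scanStop P₀ P₁ Δ a l (2 ^ θ) hN y).1 ≤ u + l - 1 :=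
      Subtype.coe_le_coe.2 (scanStop_le_of_fires hN hfire)
    have hy' : j + Δ + l < (scanStop P₀ P₁ Δ a l (2 ^ θ) hN y).1 + 2 := hy
    omega
  refine (measureReal_mono hsub).trans ((measureReal_union_le _ _).trans (add_le_add ?_ ?_))
  · refine (measureReal_biUnion_finset_le _ _).trans ?_
    refine (Finset.sum_le_sum fun k hk => ?_).trans
      (geom_sum_Ico_le_of_lt_one (m := a) (n := l + 1) (bhattacharyya_nonneg P₀ P₁) hβ)
    rw [Finset.mem_Ico] at hk
    rw [bhattacharyya_comm]
    exact pathLaw_windowLik_le P₀ P₁ P₁ P₀ (by omega) (by omega) (hwin k (by omega))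
  · exact pathLaw_windowLik_lt_mul_le P₀ P₁ hac (by omega) (by omega) (hwin l le_rfl) hM hs hsM

/-- Markov's inequality for the number of events that occur. -/
lemma measureReal_lt_card_le {Ω ι : Type*} [MeasurableSpace Ω] (μ : Measure Ω)
    [IsProbabilityMeasure μ] (I : Finset ι) {E : ι → Set Ω} (hE : ∀ p, MeasurableSet (E p))
    {F : Set Ω} (hF : MeasurableSet F) {b : ℝ} (hb : 0 < b)
    (h : ∀ ω ∈ F, b ≤ ∑ p ∈ I, (E p).indicator (1 : Ω → ℝ) ω) :
    μ.real F ≤ (∑ p ∈ I, μ.real (E p)) / b := by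
  have hint : ∀ {F : Set Ω}, MeasurableSet F → Integrable (F.indicator (1 : Ω → ℝ)) μ :=
    fun hF => (integrable_const (1 : ℝ)).indicator hF
  have h1 : ∑ p ∈ I, μ.real (E p) = ∫ ω, ∑ p ∈ I, (E p).indicator (1 : Ω → ℝ) ω ∂μ := by
    rw [integral_finsetSum _ fun j _ => hint (hE j)]
    exact Finset.sum_congr rfl fun j _ => (integral_indicator_one (hE j)).symm
  rw [le_div_iff₀ hb, ← integral_indicator_one hF, ← integral_mul_const, h1]
  refine integral_mono ((hint hF).mul_const b) (integrable_finsetSum _ fun j _ => hint (hE j))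
    fun ω => ?_
  by_cases hω : ω ∈ F
  · simpa [hω] using h ω hω
  · simp only [hω, Set.indicator_of_notMem, not_false_eq_true, zero_mul]
    exact Finset.sum_nonneg fun p _ => Set.indicator_nonneg (fun _ _ => zero_le_one) _

/-- Before the change, a test takes `a + O(1)` samples on average. -/
lemma pathLaw_scanSamples_le {n j : ℕ} (hjN : j ≤ N) (hβ : bhattacharyya P₀ P₁ < 1)
    (hΔ : 1 ≤ Δ) {b : ℝ} (hb : 0 < b) :
    (pathLaw P₀ P₁ N n j).real
      {y | b < ((scanSamples P₀ P₁ Δ a l y).filter (·.1 < j)).card} ≤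
      (j / Δ * (a + (1 - bhattacharyya P₀ P₁)⁻¹)) / b := by
  classical
  set β := bhattacharyya P₀ P₁ with hβdef
  set I : Finset (ℕ × ℕ) := ((Finset.Ioc 0 j).filter (Δ ∣ ·) ×ˢ Finset.range j).filter
    (fun p => p.1 + p.2 < j) with hI
  have hprob : ∀ p ∈ I, (pathLaw P₀ P₁ N n j).real {y | TestAlive P₀ P₁ a y p.1 p.2} ≤
      (if p.2 < a then 1 else 0) + β ^ p.2 := by
    rintro ⟨u, m⟩ hp
    simp only [hI, Finset.mem_filter, Finset.mem_product, Finset.mem_Ioc, Finset.mem_range] at hp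
    have hβm : 0 ≤ β ^ m := pow_nonneg (bhattacharyya_nonneg P₀ P₁) m
    by_cases hm : m < a
    · simp only [hm, if_true]
      exact measureReal_le_one.trans (by linarith)
    · simp only [hm, if_false, zero_add]
      refine (measureReal_mono (s₂ := {y | windowLik P₀ y u m ≤ windowLik P₁ y u m})
        fun y hy => (hy m (not_lt.1 hm) le_rfl).le).trans ?_
      exact pathLaw_windowLik_le P₀ P₁ P₀ P₁ (by omega) (by omega)
        fun t h1 h2 => if_neg (by omega)
  refine (measureReal_lt_card_le (pathLaw P₀ P₁ N n j) I
    (E := fun p => {y | TestAlive P₀ P₁ a y p.1 p.2}) (fun _ => MeasurableSet.of_discrete)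
    MeasurableSet.of_discrete hb fun y hy => ?_).trans ?_
  · have hy' : b < ((scanSamples P₀ P₁ Δ a l y).filter (·.1 < j)).card := hy
    have hcount : ∑ p ∈ I, ({y | TestAlive P₀ P₁ a y p.1 p.2} : Set (ObsTime N → 𝒴)).indicator
        (1 : (ObsTime N → 𝒴) → ℝ) y =
        ((I.filter fun p => TestAlive P₀ P₁ a y p.1 p.2).card : ℝ) := by
      rw [Finset.card_filter]
      push_cast
      exact Finset.sum_congr rfl fun p _ => by simp [Set.indicator_apply]
    rw [hcount]
    refine hy'.le.trans ?_
    have hsub : ((scanSamples P₀ P₁ Δ a l y).filter (·.1 < j)).map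
        (Function.Embedding.subtype _) ⊆
        (I.filter fun p => TestAlive P₀ P₁ a y p.1 p.2).image fun p => p.1 + p.2 := by
      intro t ht
      obtain ⟨t, htmem, rfl⟩ := Finset.mem_map.1 ht
      obtain ⟨htS, htj⟩ := Finset.mem_filter.1 htmem
      obtain ⟨u, hu, hdvd, hut, -, halive⟩ := mem_scanSamples.1 htS
      refine Finset.mem_image.2 ⟨(u, t.1 - u), ?_, ?_⟩
      · simp only [hI, Finset.mem_filter, Finset.mem_product, Finset.mem_Ioc, Finset.mem_range]
        exact ⟨⟨⟨⟨⟨hu, by omega⟩, hdvd⟩, by omega⟩, by omega⟩, halive⟩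
      · change u + (t.1 - u) = t.1
        omega
    have hcard := (Finset.card_le_card hsub).trans Finset.card_image_le
    rw [Finset.card_map] at hcard
    exact_mod_cast hcard
  · have hΔ' : (0 : ℝ) < Δ := by exact_mod_cast hΔ
    have hgeom : ∑ m ∈ Finset.range j, β ^ m ≤ (1 - β)⁻¹ := by
      have h := geom_sum_Ico_le_of_lt_one (m := 0) (n := j) (bhattacharyya_nonneg P₀ P₁) hβ
      rwa [pow_zero, one_div, ← Finset.range_eq_Ico] at h
    have hwarm : ∑ m ∈ Finset.range j, (if m < a then (1 : ℝ) else 0) ≤ a := by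
      rw [Finset.sum_ite, Finset.sum_const_zero, add_zero, Finset.sum_const, nsmul_eq_mul, mul_one]
      have hsub : (Finset.range j).filter (· < a) ⊆ Finset.range a := fun m hm =>
        Finset.mem_range.2 (Finset.mem_filter.1 hm).2
      have := Finset.card_le_card hsub
      rw [Finset.card_range] at this
      exact_mod_cast this
    have hβ0 : ∀ m, 0 ≤ β ^ m := fun m => pow_nonneg (bhattacharyya_nonneg P₀ P₁) m
    have hinv : 0 ≤ (1 - β)⁻¹ := inv_nonneg.2 (by linarith)
    gcongr
    calc ∑ p ∈ I, (pathLaw P₀ P₁ N n j).real {y | TestAlive P₀ P₁ a y p.1 p.2}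
        ≤ ∑ p ∈ I, ((if p.2 < a then (1 : ℝ) else 0) + β ^ p.2) := Finset.sum_le_sum hprob
      _ ≤ ∑ p ∈ (Finset.Ioc 0 j).filter (Δ ∣ ·) ×ˢ Finset.range j,
            ((if p.2 < a then (1 : ℝ) else 0) + β ^ p.2) :=
          Finset.sum_le_sum_of_subset_of_nonneg (Finset.filter_subset _ _) fun p _ _ =>
            add_nonneg (by split_ifs <;> norm_num) (hβ0 _)
      _ = ∑ _u ∈ (Finset.Ioc 0 j).filter (Δ ∣ ·), ∑ m ∈ Finset.range j,
            ((if m < a then (1 : ℝ) else 0) + β ^ m) := by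
          rw [Finset.sum_product]
      _ ≤ ∑ _u ∈ (Finset.Ioc 0 j).filter (Δ ∣ ·), (a + (1 - β)⁻¹) := by
          refine Finset.sum_le_sum fun u _ => ?_
          rw [Finset.sum_add_distrib]
          exact add_le_add hwarm hgeom
      _ ≤ j / Δ * (a + (1 - β)⁻¹) := by
          rw [Finset.sum_const, nsmul_eq_mul, Nat.Ioc_filter_dvd_card_eq_div]
          gcongr
          exact Nat.cast_div_le

end ScanPerformance

/-! ### Performance of the scanning detector for a uniform change point -/

section ScanJoint

variable {𝒴 : Type*} [MeasurableSpace 𝒴] [Fintype 𝒴] [DiscreteMeasurableSpace 𝒴]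
  (P₀ P₁ : PMF 𝒴) {A n : ℕ} (Δ a l : ℕ) (c : ℝ)

/-- The scanning detector is not randomized, so only the change point and the path matter. -/
lemma jointLaw_scanDetector (hA : 1 ≤ A) (hN : 1 ≤ horizon A n)
    (p : ℕ → Finset (ObsTime (horizon A n)) → ObsTime (horizon A n) → Prop) :
    (jointLaw P₀ P₁ (scanDetector P₀ P₁ Δ a l c hN)).real
      {ω | p ω.1 (scanSamples P₀ P₁ Δ a l ω.2.1) (scanStop P₀ P₁ Δ a l c hN ω.2.1)} =
    (A : ℝ)⁻¹ * ∑ j ∈ Finset.Icc 1 A, (pathLaw P₀ P₁ (horizon A n) n j).real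
      {y | p j (scanSamples P₀ P₁ Δ a l y) (scanStop P₀ P₁ Δ a l c hN y)} := by
  rw [jointLaw_real_eq P₀ P₁ _ hA fun j y =>
    measurableSet_seed (scanDetector P₀ P₁ Δ a l c hN) y (p j)]
  congr 1
  refine Finset.sum_congr rfl fun j _ => ?_
  have hset : {x : (ObsTime (horizon A n) → 𝒴) × (scanDetector P₀ P₁ Δ a l c hN).Seed |
      p j (scanSamples P₀ P₁ Δ a l x.1) (scanStop P₀ P₁ Δ a l c hN x.1)} =
      {y | p j (scanSamples P₀ P₁ Δ a l y) (scanStop P₀ P₁ Δ a l c hN y)} ×ˢ Set.univ := by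
    ext x
    simp
  have h := measureReal_prod_prod (μ := pathLaw P₀ P₁ (horizon A n) n j)
    (ν := (scanDetector P₀ P₁ Δ a l c hN).seedLaw)
    {y | p j (scanSamples P₀ P₁ Δ a l y) (scanStop P₀ P₁ Δ a l c hN y)} Set.univ
  rw [probReal_univ, mul_one] at h
  rw [← h, ← hset]
  rfl

/-- All three requirements on the scanning detector, with error probability `e`. In the rate
bound, the change points before `n ^ 3` are discarded: later on, the at most `n` samples that are
taken after the change do not contribute to the sampling rate. -/
lemma scanDetector_performance (hA : 1 ≤ A) (hN : 1 ≤ horizon A n)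
    (hac : ∀ x, P₀ x = 0 → P₁ x = 0) (hβ : bhattacharyya P₀ P₁ < 1)
    (hΔ : 1 ≤ Δ) (hl : 1 ≤ l) (hn : Δ + l ≤ n) {θ M s ρ : ℝ}
    (hM : ∀ x, |Real.log ((P₀ x).toReal / (P₁ x).toReal)| ≤ M) (hs : 0 ≤ s) (hsM : s * M ≤ 1)
    (hρ : 1 ≤ n * ρ) (hn2 : 2 ≤ n) {e₁ e₂ e₃ e : ℝ}
    (he₁ : (horizon A n : ℝ) * (2 ^ θ)⁻¹ ≤ e₁)
    (he₂ : bhattacharyya P₀ P₁ ^ a / (1 - bhattacharyya P₀ P₁) +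
      Real.exp (-(s * Real.log 2 * (l * relEntropy P₁ P₀ - θ)) + l * (s * M) ^ 2) ≤ e₂)
    (he₃ : 2 * (a + (1 - bhattacharyya P₀ P₁)⁻¹) / (Δ * ρ) ≤ e₃)
    (he : e₁ + e₂ + e₃ + (n : ℝ) ^ 3 / A ≤ e) :
    falseAlarm P₀ P₁ (scanDetector P₀ P₁ Δ a l (2 ^ θ) hN) ≤ e ∧
    samplingRate P₀ P₁ (scanDetector P₀ P₁ Δ a l (2 ^ θ) hN) e ≤ ρ ∧
    detectionDelay P₀ P₁ (scanDetector P₀ P₁ Δ a l (2 ^ θ) hN) e ≤ Δ + l := by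
  have hA0 : (0 : ℝ) < A := by exact_mod_cast hA
  have hn0 : (0 : ℝ) < n := by positivity
  have hρ0 : 0 < ρ := by
    by_contra h
    nlinarith
  have hΔ0 : (0 : ℝ) < Δ := by exact_mod_cast hΔ
  have hβ0 := bhattacharyya_nonneg P₀ P₁
  have hβ1 : 0 < 1 - bhattacharyya P₀ P₁ := by linarith
  have he₁0 : 0 ≤ e₁ := le_trans (by positivity) he₁
  have he₂0 : 0 ≤ e₂ := le_trans (by positivity) he₂
  have he₃0 : 0 ≤ e₃ := le_trans (by positivity) he₃
  have he₄0 : 0 ≤ (n : ℝ) ^ 3 / A := by positivity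
  have hcard : ((Finset.Icc 1 A).card : ℝ) = A := by simp
  -- the three exceptional events, for a given change point
  have hF : ∀ j ∈ Finset.Icc 1 A, (pathLaw P₀ P₁ (horizon A n) n j).real
      {y | (scanStop P₀ P₁ Δ a l (2 ^ θ) hN y).1 < j} ≤ e₁ := fun j hj => by
    rw [Finset.mem_Icc] at hj
    exact (pathLaw_scanStop_lt_le P₀ P₁ Δ a l (2 ^ θ) hN (by unfold horizon; omega)
      (by positivity)).trans he₁
  have hD : ∀ j ∈ Finset.Icc 1 A, (pathLaw P₀ P₁ (horizon A n) n j).real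
      {y | j + Δ + l < (scanStop P₀ P₁ Δ a l (2 ^ θ) hN y).1 + 2} ≤ e₂ := fun j hj => by
    rw [Finset.mem_Icc] at hj
    exact (pathLaw_lt_scanStop_le P₀ P₁ Δ a l hN hac hj.1 (by unfold horizon; omega) hΔ hl hn hβ
      hM hs hsM).trans he₂
  have hR : ∀ j ∈ Finset.Icc 1 A, (pathLaw P₀ P₁ (horizon A n) n j).real
      {y | ρ * j / 2 < ((scanSamples P₀ P₁ Δ a l y).filter (·.1 < j)).card} ≤ e₃ := fun j hj => by
    rw [Finset.mem_Icc] at hj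
    have hj0 : (0 : ℝ) < j := by exact_mod_cast hj.1
    refine (pathLaw_scanSamples_le P₀ P₁ Δ a l (by unfold horizon; omega) hβ hΔ
      (by positivity)).trans (le_trans (le_of_eq ?_) he₃)
    field_simp
  refine ⟨?_, ?_, ?_⟩
  · have h := jointLaw_scanDetector P₀ P₁ Δ a l (2 ^ θ) hA hN (fun j _ t => t.1 < j)
    change (jointLaw P₀ P₁ (scanDetector P₀ P₁ Δ a l (2 ^ θ) hN)).real
      {ω | (scanStop P₀ P₁ Δ a l (2 ^ θ) hN ω.2.1).1 < ω.1} ≤ e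
    rw [h, inv_mul_le_iff₀ hA0]
    refine (Finset.sum_le_card_nsmul _ _ _ hF).trans ?_
    rw [nsmul_eq_mul, hcard]
    gcongr
    linarith
  · refine csInf_le ⟨0, fun x hx => hx.1⟩ ⟨hρ0.le, ?_⟩
    have h := jointLaw_scanDetector P₀ P₁ Δ a l (2 ^ θ) hA hN
      (fun _ S t => ((S.filter (· ≤ t)).card : ℝ) / (t.1 : ℝ) ≤ ρ)
    change 1 - e ≤ (jointLaw P₀ P₁ (scanDetector P₀ P₁ Δ a l (2 ^ θ) hN)).real
      {ω | (((scanSamples P₀ P₁ Δ a l ω.2.1).filter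
          (· ≤ scanStop P₀ P₁ Δ a l (2 ^ θ) hN ω.2.1)).card : ℝ) /
        ((scanStop P₀ P₁ Δ a l (2 ^ θ) hN ω.2.1).1 : ℝ) ≤ ρ}
    rw [h]
    have hj : ∀ j ∈ Finset.Icc 1 A, 1 - (e₁ + e₂ + e₃) - (if j ≤ n ^ 3 then 1 else 0) ≤
        (pathLaw P₀ P₁ (horizon A n) n j).real
          {y | (((scanSamples P₀ P₁ Δ a l y).filter
            (· ≤ scanStop P₀ P₁ Δ a l (2 ^ θ) hN y)).card : ℝ) /
            ((scanStop P₀ P₁ Δ a l (2 ^ θ) hN y).1 : ℝ) ≤ ρ} := by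
      intro j hj
      split_ifs with hjn
      · exact le_trans (by linarith) measureReal_nonneg
      rw [sub_zero]
      have hsub : {y : ObsTime (horizon A n) → 𝒴 | (((scanSamples P₀ P₁ Δ a l y).filter
            (· ≤ scanStop P₀ P₁ Δ a l (2 ^ θ) hN y)).card : ℝ) /
            ((scanStop P₀ P₁ Δ a l (2 ^ θ) hN y).1 : ℝ) ≤ ρ}ᶜ ⊆
          ({y | (scanStop P₀ P₁ Δ a l (2 ^ θ) hN y).1 < j} ∪
          {y | j + Δ + l < (scanStop P₀ P₁ Δ a l (2 ^ θ) hN y).1 + 2}) ∪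
          {y | ρ * j / 2 < ((scanSamples P₀ P₁ Δ a l y).filter (·.1 < j)).card} := by
        intro y hy
        by_contra hno
        simp only [Set.mem_union, not_or] at hno
        obtain ⟨⟨h1, h2⟩, h3⟩ := hno
        refine hy ?_
        set τ := scanStop P₀ P₁ Δ a l (2 ^ θ) hN y
        have h1' : j ≤ τ.1 := not_lt.1 h1
        have h2' : τ.1 + 2 ≤ j + Δ + l := not_lt.1 h2
        have h3' : (((scanSamples P₀ P₁ Δ a l y).filter (·.1 < j)).card : ℝ) ≤ ρ * j / 2 :=
          not_lt.1 h3
        have hj1 := (Finset.mem_Icc.1 hj).1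
        have hsplit : ((scanSamples P₀ P₁ Δ a l y).filter (· ≤ τ)).card ≤
            ((scanSamples P₀ P₁ Δ a l y).filter (·.1 < j)).card + n := by
          have hss : ((scanSamples P₀ P₁ Δ a l y).filter (· ≤ τ)) ⊆
              ((scanSamples P₀ P₁ Δ a l y).filter (·.1 < j)) ∪ window _ j n := by
            intro t ht
            obtain ⟨htS, htτ⟩ := Finset.mem_filter.1 ht
            have htτ' : t.1 ≤ τ.1 := htτ
            rw [Finset.mem_union, Finset.mem_filter, mem_window]
            by_cases htj : t.1 < j
            · exact Or.inl ⟨htS, htj⟩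
            · exact Or.inr (by omega)
          refine (Finset.card_le_card hss).trans ((Finset.card_union_le _ _).trans ?_)
          rw [card_window hj1 (by unfold horizon; have := (Finset.mem_Icc.1 hj).2; omega)]
        have hsplit' : (((scanSamples P₀ P₁ Δ a l y).filter (· ≤ τ)).card : ℝ) ≤
            ((scanSamples P₀ P₁ Δ a l y).filter (·.1 < j)).card + n := by exact_mod_cast hsplit
        have hτ0 : (0 : ℝ) < τ.1 := by exact_mod_cast (by omega : 0 < τ.1)
        change (((scanSamples P₀ P₁ Δ a l y).filter (· ≤ τ)).card : ℝ) / (τ.1 : ℝ) ≤ ρ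
        rw [div_le_iff₀ hτ0]
        have hjτ : (j : ℝ) ≤ τ.1 := by exact_mod_cast h1'
        have hjn' : (n : ℝ) ^ 3 ≤ j := by exact_mod_cast (not_le.1 hjn).le
        have hn2' : (2 : ℝ) ≤ n := by exact_mod_cast hn2
        have h4 : (n : ℝ) ≤ ρ * j / 2 := by
          have h5 : ρ * (n : ℝ) ^ 3 ≤ ρ * j := by gcongr
          have h6 : (n : ℝ) ^ 2 * 1 ≤ (n : ℝ) ^ 2 * (n * ρ) := by gcongr
          nlinarith
        have h7 : ρ * j ≤ ρ * τ.1 := by gcongr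
        linarith
      have hbad := (measureReal_mono hsub (measure_ne_top (pathLaw P₀ P₁ (horizon A n) n j) _)).trans
        ((measureReal_union_le _ _).trans (add_le_add ((measureReal_union_le _ _).trans
          (add_le_add (hF j hj) (hD j hj))) (hR j hj)))
      rw [probReal_compl_eq_one_sub MeasurableSet.of_discrete] at hbad
      linarith
    have hsum := Finset.sum_le_sum hj
    rw [Finset.sum_sub_distrib, Finset.sum_const, nsmul_eq_mul, hcard] at hsum
    have hsmall : ∑ j ∈ Finset.Icc 1 A, (if j ≤ n ^ 3 then (1 : ℝ) else 0) ≤ (n : ℝ) ^ 3 := by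
      rw [Finset.sum_ite, Finset.sum_const_zero, add_zero, Finset.sum_const, nsmul_eq_mul, mul_one]
      have hss : (Finset.Icc 1 A).filter (· ≤ n ^ 3) ⊆ Finset.Icc 1 (n ^ 3) := fun j hj => by
        rw [Finset.mem_filter, Finset.mem_Icc] at hj
        exact Finset.mem_Icc.2 ⟨hj.1.1, hj.2⟩
      have hc := Finset.card_le_card hss
      rw [Nat.card_Icc, Nat.add_sub_cancel] at hc
      exact_mod_cast hc
    have hfin : (A : ℝ) * (1 - e) ≤ A * (1 - (e₁ + e₂ + e₃)) - (n : ℝ) ^ 3 := by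
      have h5 : (A : ℝ) * (e₁ + e₂ + e₃ + (n : ℝ) ^ 3 / A) ≤ A * e := by gcongr
      have h6 : (A : ℝ) * ((n : ℝ) ^ 3 / A) = (n : ℝ) ^ 3 := by field_simp
      nlinarith
    rw [le_inv_mul_iff₀ hA0]
    linarith
  · refine Nat.sInf_le ?_
    have h := jointLaw_scanDetector P₀ P₁ Δ a l (2 ^ θ) hA hN
      (fun j _ t => (t.1 : ℤ) - (j : ℤ) ≤ ((Δ + l : ℕ) : ℤ) - 1)
    change 1 - e ≤ (jointLaw P₀ P₁ (scanDetector P₀ P₁ Δ a l (2 ^ θ) hN)).real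
      {ω | ((scanStop P₀ P₁ Δ a l (2 ^ θ) hN ω.2.1).1 : ℤ) - (ω.1 : ℤ) ≤ ((Δ + l : ℕ) : ℤ) - 1}
    rw [h]
    have hj : ∀ j ∈ Finset.Icc 1 A, 1 - e₂ ≤ (pathLaw P₀ P₁ (horizon A n) n j).real
        {y | ((scanStop P₀ P₁ Δ a l (2 ^ θ) hN y).1 : ℤ) - (j : ℤ) ≤ ((Δ + l : ℕ) : ℤ) - 1} := by
      intro j hj
      have hsub : {y : ObsTime (horizon A n) → 𝒴 |
          ((scanStop P₀ P₁ Δ a l (2 ^ θ) hN y).1 : ℤ) - (j : ℤ) ≤ ((Δ + l : ℕ) : ℤ) - 1}ᶜ ⊆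
          {y | j + Δ + l < (scanStop P₀ P₁ Δ a l (2 ^ θ) hN y).1 + 2} := by
        intro y hy
        have hy' : ¬ ((scanStop P₀ P₁ Δ a l (2 ^ θ) hN y).1 : ℤ) - (j : ℤ) ≤
          ((Δ + l : ℕ) : ℤ) - 1 := hy
        change j + Δ + l < (scanStop P₀ P₁ Δ a l (2 ^ θ) hN y).1 + 2
        omega
      have hbad := (measureReal_mono hsub (measure_ne_top (pathLaw P₀ P₁ (horizon A n) n j) _)).trans
        (hD j hj)
      rw [probReal_compl_eq_one_sub MeasurableSet.of_discrete] at hbad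
      linarith
    have hsum := Finset.card_nsmul_le_sum _ _ _ hj
    rw [nsmul_eq_mul, hcard] at hsum
    rw [le_inv_mul_iff₀ hA0]
    refine le_trans ?_ hsum
    gcongr
    linarith

end ScanJoint

/-! ### Asymptotics of the scanning detector -/

section Achievability

lemma ne_of_relEntropy_pos {𝒴 : Type*} [Fintype 𝒴] {P Q : PMF 𝒴} (h : 0 < relEntropy P Q) :
    Q ≠ P := by
  rintro rfl
  refine h.ne' (Finset.sum_eq_zero fun x _ => ?_)
  by_cases hx : (Q x).toReal = 0
  · simp [hx]
  · simp [div_self hx]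

lemma tendsto_mul_atTop_of_isLittleO {ρ : ℕ → ℝ} (hρ0 : ∀ n, 0 ≤ ρ n)
    (hρ : (fun n : ℕ => 1 / (n : ℝ)) =o[atTop] ρ) :
    Tendsto (fun n : ℕ => (n : ℝ) * ρ n) atTop atTop := by
  refine tendsto_atTop.2 fun C => ?_
  have hC : 0 < |C| + 1 := by positivity
  filter_upwards [hρ.bound (inv_pos.2 hC), eventually_gt_atTop 0] with n hn hn0
  have hn1 : (0 : ℝ) < n := by exact_mod_cast hn0
  rw [Real.norm_of_nonneg (by positivity), Real.norm_of_nonneg (hρ0 n), inv_mul_eq_div,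
    div_le_div_iff₀ hn1 hC] at hn
  have := le_abs_self C
  linarith

/-- The fourth root of `n`, in terms of which the second-order terms are chosen. -/
noncomputable def fourthRoot (n : ℕ) : ℝ := √√(n : ℝ)

lemma fourthRoot_pow (n : ℕ) : fourthRoot n ^ 4 = n := by
  have h1 : fourthRoot n ^ 2 = √(n : ℝ) := Real.sq_sqrt (Real.sqrt_nonneg _)
  have h2 : (√(n : ℝ)) ^ 2 = n := Real.sq_sqrt (by positivity)
  calc fourthRoot n ^ 4 = (fourthRoot n ^ 2) ^ 2 := by ring
    _ = (n : ℝ) := by rw [h1, h2]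

lemma fourthRoot_nonneg (n : ℕ) : 0 ≤ fourthRoot n := Real.sqrt_nonneg _

lemma tendsto_fourthRoot : Tendsto fourthRoot atTop atTop :=
  Real.tendsto_sqrt_atTop.comp (Real.tendsto_sqrt_atTop.comp tendsto_natCast_atTop_atTop)

variable {𝒴 : Type*} [MeasurableSpace 𝒴] [Fintype 𝒴] [DiscreteMeasurableSpace 𝒴]

/-- An upper bound for the delay of the scanning detector: the distance between the starts of
two tests, plus the length of a test. -/
noncomputable def delayBound (α D w : ℝ) (n : ℕ) : ℝ :=
  n / √w + 2 + (α * n + 2 * fourthRoot n ^ 3) / D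

lemma tendsto_delayBound_div (α D : ℝ) {w : ℕ → ℝ} (hw : Tendsto w atTop atTop) :
    Tendsto (fun n : ℕ => delayBound α D (w n) n / n) atTop (𝓝 (α / D)) := by
  have h1 : Tendsto (fun n : ℕ => (√(w n))⁻¹) atTop (𝓝 0) :=
    tendsto_inv_atTop_zero.comp (Real.tendsto_sqrt_atTop.comp hw)
  have h2 : Tendsto (fun n : ℕ => 2 * (1 / (n : ℝ))) atTop (𝓝 (2 * 0)) :=
    (tendsto_one_div_atTop_nhds_zero_nat (𝕜 := ℝ)).const_mul 2
  have h3 : Tendsto (fun n : ℕ => 2 / D * (fourthRoot n)⁻¹) atTop (𝓝 (2 / D * 0)) :=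
    (tendsto_inv_atTop_zero.comp tendsto_fourthRoot).const_mul _
  have h4 := ((h1.add h2).add (tendsto_const_nhds (x := α / D))).add h3
  simp only [mul_zero, add_zero, zero_add] at h4
  refine h4.congr' ?_
  filter_upwards [eventually_gt_atTop 0, tendsto_fourthRoot.eventually_gt_atTop 0] with n hn hq
  have hn0 : (n : ℝ) ≠ 0 := by positivity
  have hq3 : fourthRoot n ^ 3 / n = (fourthRoot n)⁻¹ := by
    rw [← fourthRoot_pow n]
    field_simp
  rw [← hq3]
  unfold delayBound
  field_simp
  ring

/-- The error level of the scanning detector. The summands bound the false-alarm probability, the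
probability of giving up a test after the change, the probability of a small final likelihood
ratio, the probability of oversampling before the change, the probability of an early change
point, and the exponential growth rate of the delay. -/
noncomputable def scanError (α β κ w : ℝ) (n : ℕ) : ℝ :=
  2 * 2 ^ (-(fourthRoot n ^ 3)) +
    (β ^ ⌈√√w⌉₊ / (1 - β) + Real.exp (-(κ * fourthRoot n ^ 2))) +
    2 * (√√w + 1 + (1 - β)⁻¹) / √w + (n : ℝ) ^ 3 / uncertaintyLevel α n + Real.logb 2 n / n

lemma tendsto_scanError {α β κ : ℝ} (hα : 0 < α) (hβ0 : 0 ≤ β) (hβ : β < 1) (hκ : 0 < κ)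
    {w : ℕ → ℝ} (hw : Tendsto w atTop atTop) :
    Tendsto (fun n => scanError α β κ (w n) n) atTop (𝓝 0) := by
  have hq := tendsto_fourthRoot
  have hs := Real.tendsto_sqrt_atTop.comp hw
  have hss := Real.tendsto_sqrt_atTop.comp hs
  have h1 : Tendsto (fun n => 2 * (2 : ℝ) ^ (-(fourthRoot n ^ 3))) atTop (𝓝 (2 * 0)) := by
    refine Tendsto.const_mul 2 ?_
    have h := tendsto_rpow_atBot_of_base_gt_one 2 (by norm_num)
    exact h.comp (tendsto_neg_atTop_atBot.comp
      ((tendsto_pow_atTop (by norm_num : (3 : ℕ) ≠ 0)).comp hq))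
  have h2 : Tendsto (fun n => β ^ ⌈√√(w n)⌉₊ / (1 - β)) atTop (𝓝 (0 / (1 - β))) :=
    ((tendsto_pow_atTop_nhds_zero_of_lt_one hβ0 hβ).comp
      (tendsto_nat_ceil_atTop.comp hss)).div_const _
  have h3 : Tendsto (fun n => Real.exp (-(κ * fourthRoot n ^ 2))) atTop (𝓝 0) :=
    Real.tendsto_exp_neg_atTop_nhds_zero.comp
      (((tendsto_pow_atTop (by norm_num : (2 : ℕ) ≠ 0)).comp hq).const_mul_atTop hκ)
  have h4 : Tendsto (fun n => 2 * (√√(w n) + 1 + (1 - β)⁻¹) / √(w n)) atTop (𝓝 0) := by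
    have h5 : Tendsto (fun n => 2 * (√√(w n))⁻¹ + 2 * (1 + (1 - β)⁻¹) * (√(w n))⁻¹) atTop
        (𝓝 (2 * 0 + 2 * (1 + (1 - β)⁻¹) * 0)) :=
      ((tendsto_inv_atTop_zero.comp hss).const_mul _).add
        ((tendsto_inv_atTop_zero.comp hs).const_mul _)
    rw [mul_zero, mul_zero, add_zero] at h5
    refine h5.congr' ?_
    filter_upwards [hss.eventually_gt_atTop 0] with n hn
    have hn' : 0 < √√(w n) := hn
    have hsq : √(w n) = √√(w n) ^ 2 := (Real.sq_sqrt (Real.sqrt_nonneg _)).symm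
    set z := √√(w n)
    rw [hsq]
    field_simp
    ring
  have h6 := tendsto_pow_div_uncertaintyLevel hα 3
  have h7 : Tendsto (fun n : ℕ => Real.logb 2 n / n) atTop (𝓝 0) := by
    have h8 : Tendsto (fun n : ℕ => Real.log n / n / Real.log 2) atTop (𝓝 (0 / Real.log 2)) :=
      ((Real.isLittleO_log_id_atTop.tendsto_div_nhds_zero).comp
        tendsto_natCast_atTop_atTop).div_const _
    rw [zero_div] at h8
    refine h8.congr fun n => ?_
    rw [Real.logb, div_right_comm]
  have h9 := (((h1.add (h2.add h3)).add h4).add h6).add h7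
  simpa [scanError] using h9

lemma scanError_nonneg {α β κ w : ℝ} (hβ0 : 0 ≤ β) (hβ : β < 1) (n : ℕ) :
    0 ≤ scanError α β κ w n := by
  have h1 : 0 < 1 - β := by linarith
  have h2 : 0 ≤ Real.logb 2 n / n := by
    rcases Nat.eq_zero_or_pos n with rfl | hn
    · simp
    · have : 0 ≤ Real.logb 2 n := Real.logb_nonneg (by norm_num) (by exact_mod_cast hn)
      positivity
  unfold scanError
  positivity

/-- With `w = n * ρ n → ∞`, tests start at distance about `n / √w`, which is `o(n)` but much larger
than `1 / ρ n`, and their warm-up of about `w ^ (1/4)` samples diverges but is `o(√w)`. The final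
likelihood ratio is compared to `2 ^ (α n + q ^ 3)` after a test of mean log-likelihood ratio
`α n + 2 q ^ 3`, where `q = n ^ (1/4)`: both margins `q ^ 3` are `o(n)`, but larger than the
fluctuations, which are of order `q ^ 2`. -/
theorem exists_detectors_of_isLittleO (P₀ P₁ : PMF 𝒴) (hac : ∀ x, P₀ x = 0 → P₁ x = 0) {α : ℝ}
    (hα : 0 < α) (hαD : α < relEntropy P₁ P₀) {ρ : ℕ → ℝ} (hρ : IsRateSequence ρ)
    (hρn : (fun n : ℕ => 1 / (n : ℝ)) =o[atTop] ρ) :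
    ∃ (D : DetectorSeq 𝒴 α) (ε : ℕ → ℝ), Achieves P₀ P₁ D ε ρ ∧
      limsup (fun n : ℕ => (((detectionDelay P₀ P₁ (D n) (ε n) : ℝ) /
        (n * α / relEntropy P₁ P₀) : ℝ) : EReal)) atTop ≤ 1 := by
  classical
  set R := relEntropy P₁ P₀ with hR
  have hR0 : 0 < R := hα.trans hαD
  set β := bhattacharyya P₀ P₁ with hβdef
  have hβ0 : 0 ≤ β := bhattacharyya_nonneg P₀ P₁
  have hβ : β < 1 := bhattacharyya_lt_one (ne_of_relEntropy_pos hR0)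
  obtain ⟨M, hM0, hM⟩ : ∃ M, 0 ≤ M ∧
      ∀ x, |Real.log ((P₀ x).toReal / (P₁ x).toReal)| ≤ M :=
    ⟨∑ x, |Real.log ((P₀ x).toReal / (P₁ x).toReal)|, by positivity, fun x =>
      Finset.single_le_sum (f := fun x => |Real.log ((P₀ x).toReal / (P₁ x).toReal)|)
        (fun _ _ => abs_nonneg _) (Finset.mem_univ x)⟩
  have hlog2 : 0 < Real.log 2 := Real.log_pos (by norm_num)
  -- `K` is so large that the linear term of the exponent dominates the quadratic one
  set K := 2 * M ^ 2 / Real.log 2 + M + 1 with hK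
  have hK0 : 0 < K := by positivity
  have hKM : M ≤ K := by
    have : 0 ≤ 2 * M ^ 2 / Real.log 2 := by positivity
    linarith
  have hKM2 : 2 * M ^ 2 ≤ K * Real.log 2 := by
    have h1 : 2 * M ^ 2 / Real.log 2 ≤ K := by linarith
    rwa [div_le_iff₀ hlog2] at h1
  set κ := Real.log 2 / (2 * K) with hκ
  have hκ0 : 0 < κ := by positivity
  set w : ℕ → ℝ := fun n => n * ρ n with hw
  have hwtop : Tendsto w atTop atTop := tendsto_mul_atTop_of_isLittleO (fun n => (hρ.2 n).1) hρn
  set Δ : ℕ → ℕ := fun n => ⌈n / √(w n)⌉₊ with hΔ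
  set a : ℕ → ℕ := fun n => ⌈√√(w n)⌉₊ with ha
  set θ : ℕ → ℝ := fun n => α * n + fourthRoot n ^ 3 with hθ
  set l : ℕ → ℕ := fun n => ⌈(α * n + 2 * fourthRoot n ^ 3) / R⌉₊ with hl
  have hN : ∀ n, 1 ≤ horizon (uncertaintyLevel α n) n := fun n =>
    (one_le_uncertaintyLevel hα n).trans (Nat.le_add_right _ _)
  set D : DetectorSeq 𝒴 α := fun n =>
    scanDetector P₀ P₁ (Δ n) (a n) (l n) (2 ^ θ n) (hN n) with hD
  set ε : ℕ → ℝ := fun n => scanError α β κ (w n) n with hε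
  have hdelay : ∀ n, ((Δ n + l n : ℕ) : ℝ) ≤ delayBound α R (w n) n := by
    intro n
    have h1 : (Δ n : ℝ) < n / √(w n) + 1 := Nat.ceil_lt_add_one (by positivity)
    have h2 : (l n : ℝ) < (α * n + 2 * fourthRoot n ^ 3) / R + 1 := Nat.ceil_lt_add_one (by
      have := fourthRoot_nonneg n
      positivity)
    unfold delayBound
    push_cast
    linarith
  have hshort : ∀ᶠ n : ℕ in atTop, Δ n + l n ≤ n := by
    filter_upwards [(tendsto_delayBound_div α R hwtop).eventually_lt_const
      ((div_lt_one hR0).2 hαD), eventually_gt_atTop 0] with n h1 h2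
    rw [div_lt_one (by exact_mod_cast h2)] at h1
    exact_mod_cast (hdelay n).trans h1.le
  have hperf : ∀ᶠ n : ℕ in atTop, falseAlarm P₀ P₁ (D n) ≤ ε n ∧
      samplingRate P₀ P₁ (D n) (ε n) ≤ ρ n ∧
      detectionDelay P₀ P₁ (D n) (ε n) ≤ Δ n + l n := by
    filter_upwards [hshort, hwtop.eventually_ge_atTop 1, tendsto_fourthRoot.eventually_ge_atTop 1,
      eventually_ge_atTop 2, eventually_mul_le_uncertaintyLevel hα 1 1] with n h1 h2 h3 h4 h5
    have hn0 : (0 : ℝ) < n := by positivity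
    have hw1 : 0 < √(w n) := Real.sqrt_pos.2 (by linarith)
    have hq0 : 0 < fourthRoot n := by linarith
    have hln : (l n : ℝ) ≤ fourthRoot n ^ 4 := by
      rw [fourthRoot_pow]
      exact_mod_cast (by omega : l n ≤ n)
    have hsqrt : √(w n) ≤ Δ n * ρ n := by
      have h6 : n / √(w n) ≤ Δ n := Nat.le_ceil _
      calc √(w n) = n / √(w n) * ρ n := by
            rw [div_mul_eq_mul_div, eq_div_iff hw1.ne']
            exact Real.mul_self_sqrt (by linarith)
        _ ≤ Δ n * ρ n := by
            gcongr
            exact (hρ.2 n).1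
    refine scanDetector_performance P₀ P₁ (Δ n) (a n) (l n) (one_le_uncertaintyLevel hα n) (hN n)
      hac hβ (Nat.ceil_pos.2 (by positivity)) (Nat.ceil_pos.2 (by positivity)) h1 hM
      (s := (K * fourthRoot n)⁻¹) (by positivity) ?_ h2 h4
      (e₁ := 2 * 2 ^ (-(fourthRoot n ^ 3)))
      (e₂ := β ^ a n / (1 - β) + Real.exp (-(κ * fourthRoot n ^ 2)))
      (e₃ := 2 * (√√(w n) + 1 + (1 - β)⁻¹) / √(w n)) ?_ ?_ ?_ ?_
    · rw [inv_mul_le_iff₀ (by positivity), mul_one]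
      nlinarith
    · have h6 : (horizon (uncertaintyLevel α n) n : ℝ) ≤ 2 * 2 ^ (α * n) := by
        have h7 := uncertaintyLevel_le α n
        have h8 : (horizon (uncertaintyLevel α n) n : ℝ) ≤ uncertaintyLevel α n + n := by
          unfold horizon
          exact_mod_cast (by omega)
        rw [one_mul, pow_one] at h5
        linarith
      calc (horizon (uncertaintyLevel α n) n : ℝ) * ((2 : ℝ) ^ θ n)⁻¹
          ≤ 2 * 2 ^ (α * n) * ((2 : ℝ) ^ θ n)⁻¹ := by gcongr
        _ = 2 * 2 ^ (-(fourthRoot n ^ 3)) := by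
          rw [← Real.rpow_neg (by norm_num), mul_assoc, ← Real.rpow_add (by norm_num)]
          congr 2
          simp only [hθ]
          ring
    · gcongr
      have h6 : fourthRoot n ^ 3 ≤ l n * R - θ n := by
        have h7 : (α * n + 2 * fourthRoot n ^ 3) / R ≤ l n := Nat.le_ceil _
        rw [div_le_iff₀ hR0] at h7
        simp only [hθ]
        linarith
      have h8 : (K * fourthRoot n)⁻¹ * Real.log 2 * fourthRoot n ^ 3 ≤
          (K * fourthRoot n)⁻¹ * Real.log 2 * (l n * R - θ n) := by gcongr
      have h9 : (l n : ℝ) * ((K * fourthRoot n)⁻¹ * M) ^ 2 ≤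
          fourthRoot n ^ 4 * ((K * fourthRoot n)⁻¹ * M) ^ 2 := by gcongr
      have h10 : (K * fourthRoot n)⁻¹ * Real.log 2 * fourthRoot n ^ 3 =
          2 * (κ * fourthRoot n ^ 2) := by
        rw [hκ]
        field_simp
      have h11 : fourthRoot n ^ 4 * ((K * fourthRoot n)⁻¹ * M) ^ 2 ≤ κ * fourthRoot n ^ 2 := by
        have h12 : fourthRoot n ^ 4 * ((K * fourthRoot n)⁻¹ * M) ^ 2 =
            2 * M ^ 2 / (2 * K ^ 2) * fourthRoot n ^ 2 := by field_simp
        have h13 : κ = K * Real.log 2 / (2 * K ^ 2) := by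
          rw [hκ]
          field_simp
        rw [h12, h13]
        gcongr
      linarith
    · have h6 : (a n : ℝ) ≤ √√(w n) + 1 := (Nat.ceil_lt_add_one (Real.sqrt_nonneg _)).le
      have h7 : 0 < (1 - β)⁻¹ := inv_pos.2 (by linarith)
      have h8 : 0 ≤ √√(w n) := Real.sqrt_nonneg _
      gcongr
    · have h6 : 0 ≤ Real.logb 2 n / n :=
        div_nonneg (Real.logb_nonneg (by norm_num) (by exact_mod_cast (by omega : 1 ≤ n))) hn0.le
      simp only [hε, scanError]
      linarith
  refine ⟨D, ε, ⟨⟨fun n => scanError_nonneg hβ0 hβ n,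
    tendsto_scanError hα hβ0 hβ hκ0 hwtop⟩, ?_⟩, ?_⟩
  · filter_upwards [hperf, hshort, eventually_gt_atTop 0] with n h1 h2 h3
    refine ⟨h1.1, h1.2.1, ?_⟩
    have hn0 : (0 : ℝ) < n := by exact_mod_cast h3
    have h4 : Real.logb 2 (detectionDelay P₀ P₁ (D n) (ε n)) ≤ Real.logb 2 n := by
      rcases Nat.eq_zero_or_pos (detectionDelay P₀ P₁ (D n) (ε n)) with h0 | h0
      · rw [h0, Nat.cast_zero, Real.logb_zero]
        exact Real.logb_nonneg (by norm_num) (by exact_mod_cast h3)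
      · refine Real.logb_le_logb_of_le (by norm_num) (by exact_mod_cast h0) ?_
        exact_mod_cast h1.2.2.trans h2
    have h5 : Real.logb 2 n / n ≤ ε n := by
      have h6 : 0 < 1 - β := by linarith
      simp only [hε, scanError]
      have h7 : 0 ≤ 2 * (2 : ℝ) ^ (-(fourthRoot n ^ 3)) +
          (β ^ ⌈√√(w n)⌉₊ / (1 - β) + Real.exp (-(κ * fourthRoot n ^ 2))) +
          2 * (√√(w n) + 1 + (1 - β)⁻¹) / √(w n) + (n : ℝ) ^ 3 / uncertaintyLevel α n := by
        positivity
      linarith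
    refine le_trans ?_ h5
    rw [one_div, inv_mul_eq_div]
    gcongr
  · have hlim : Tendsto (fun n : ℕ => ((delayBound α R (w n) n / (n * α / R) : ℝ) : EReal)) atTop
        (𝓝 ((1 : ℝ) : EReal)) := by
      refine (continuous_coe_real_ereal.tendsto _).comp ?_
      have h1 := (tendsto_delayBound_div α R hwtop).div_const (α / R)
      rw [div_self (by positivity)] at h1
      refine h1.congr fun n => ?_
      rw [div_div, mul_div_assoc]
    rw [EReal.coe_one] at hlim
    rw [← hlim.limsup_eq]
    refine limsup_le_limsup ?_
    filter_upwards [hperf] with n hn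
    refine EReal.coe_le_coe_iff.2 ?_
    have h2 : (detectionDelay P₀ P₁ (D n) (ε n) : ℝ) ≤ delayBound α R (w n) n :=
      le_trans (by exact_mod_cast hn.2.2) (hdelay n)
    gcongr

end Achievability

theorem theorem2 {𝒴 : Type*} [Fintype 𝒴] [MeasurableSpace 𝒴] [DiscreteMeasurableSpace 𝒴]
    (P₀ P₁ : PMF 𝒴) (hfin : ∀ y, P₀ y = 0 → P₁ y = 0)
    (α : ℝ) (hα0 : 0 < α) (hαD : α < relEntropy P₁ P₀) :
    -- achievability
    (∀ ρ : ℕ → ℝ, IsRateSequence ρ → (fun n : ℕ => 1 / (n : ℝ)) =o[atTop] ρ →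
      ∃ (D : DetectorSeq 𝒴 α) (ε : ℕ → ℝ), Achieves P₀ P₁ D ε ρ ∧
        limsup (fun n : ℕ => (((detectionDelay P₀ P₁ (D n) (ε n) : ℝ) /
          (n * α / relEntropy P₁ P₀) : ℝ) : EReal)) atTop ≤ 1) ∧
    -- converse
    (∀ ρ : ℕ → ℝ, IsRateSequence ρ → ρ =o[atTop] (fun n : ℕ => 1 / (n : ℝ)) →
      ¬ IsAchievable P₀ P₁ α ρ ∧
      (∃ δ : ℝ, 0 < δ ∧ ∀ (D : DetectorSeq 𝒴 α) (ε : ℕ → ℝ), IsVanishing ε →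
        (∀ᶠ n : ℕ in atTop, samplingRate P₀ P₁ (D n) (ε n) ≤ ρ n) →
        ∀ᶠ n : ℕ in atTop, δ ≤ missProb P₀ P₁ (D n)) ∧
      (∀ (D : DetectorSeq 𝒴 α) (ε : ℕ → ℝ), IsVanishing ε →
        (∀ᶠ n : ℕ in atTop, samplingRate P₀ P₁ (D n) (ε n) ≤ ρ n) →
        Tendsto (fun n : ℕ => falseAlarm P₀ P₁ (D n)) atTop (𝓝 0) →
        (fun n : ℕ => (detectionDelay P₀ P₁ (D n) (ε n) : ℝ)) =Θ[atTop]
          (fun n : ℕ => (2 : ℝ) ^ (α * n)))) := by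
  refine ⟨fun ρ hρ hρn => exists_detectors_of_isLittleO P₀ P₁ hfin hα0 hαD hρ hρn,
    fun ρ _ hρn => ⟨not_isAchievable P₀ P₁ hα0 hρn, ⟨1 / 8, by norm_num, fun D ε hε hrate =>
      eventually_le_missProb P₀ P₁ hα0 hρn D ε hε hrate⟩, fun D ε hε hrate hfa =>
        detectionDelay_isTheta P₀ P₁ hα0 hρn D ε hε hrate hfa⟩⟩
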